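/- Let $X$ be a complex surface, i.e. a complex manifold of dimension $2$, and let $m\ge 0$ be an integer. For $x\in X$ let $J_{3,x}$ be the space of $3$-jets at $0$ of germs of holomorphic curves $f:(\mathbb C,0)\to (X,x)$. Let $E_{3,m}T_X^*$ be the holomorphic vector bundle of invariant jet differentials of order $3$ and degree $m$: its fibre at $x$ consists of the functions $Q$ on $J_{3,x}$ which are polynomials in the components of $f',f'',f'''$ in a chart, such that $$Q((f\circ\varphi)',(f\circ\varphi)'',(f\circ\varphi)''')=\varphi'(0)^m\,Q(f',f'',f''')$$ for every germ $\varphi$ of biholomorphism of $(\mathbb C,0)$. A monomial has multidegree $l=(l_1,l_2,l_3)$ if it has degree $l_j$ in the components of $f^{(j)}$. Multidegrees are ordered lexicographically, comparing first $l_3$, then $l_2$, then $l_1$. The polynomials all of whose monomials have multidegree $\le l$ define a filtration of $E_{3,m}T_X^*$ that does not depend on the chart. Let $\mathrm{Gr}^\bullet E_{3,m}T_X^*$ be the direct sum of its graded pieces $\mathrm{Gr}^l$ over the $l$ with $l_1+2l_2+3l_3=m$. For a partition $\lambda=(\lambda_1,\lambda_2)$ let $\Gamma^{\lambda}$ denote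 the Schur functor. Then there is an isomorphism of holomorphic vector bundles on $X$ $$\mathrm{Gr}^\bullet E_{3,m}T_X^*\;\cong\;\bigoplus_{0\le\gamma\le m/5}\ \ \bigoplus_{\substack{\lambda_1+2\lambda_2=m-\gamma\\ \lambda_1-\lambda_2\ge\gamma,\ \lambda_2\ge\gamma}}\Gamma^{(\lambda_1,\lambda_2)}T_X^*,$$ where $\gamma,\lambda_1,\lambda_2$ are integers and each triple $(\gamma,\lambda_1,\lambda_2)$ contributes exactly one summand. -/

import Mathlib

open scoped Manifold ContDiff DirectSum TensorProduct Topology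

noncomputable section

namespace JetDiff

/-! ### Jets of holomorphic curves -/

section Jets

variable {n : ℕ} {X : Type*} [TopologicalSpace X] [ChartedSpace (EuclideanSpace ℂ (Fin n)) X]

/-- Representatives of germs of holomorphic curves `(ℂ, 0) → (X, x)`. -/
structure Curve (x : X) where
  toFun : ℂ → X
  map_zero : toFun 0 = x
  holo : ContMDiffAt 𝓘(ℂ, ℂ) 𝓘(ℂ, EuclideanSpace ℂ (Fin n)) ω toFun 0

/-- Representatives of germs of biholomorphisms `φ : (ℂ, 0) → (ℂ, 0)`. -/
structure Reparam where
  toFun : ℂ → ℂ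
  map_zero : toFun 0 = 0
  holo : AnalyticAt ℂ toFun 0
  deriv_ne : deriv toFun 0 ≠ 0

/-- The dilation `t ↦ c t`. -/
def Reparam.scale (c : ℂ) (hc : c ≠ 0) : Reparam where
  toFun := fun t => c * t
  map_zero := by simp
  holo := by fun_prop
  deriv_ne := by
    have h : deriv (fun t : ℂ => c * t) 0 = c := by
      simp
    rwa [h]

/-- The curve `f ∘ φ`. -/
def Curve.comp {x : X} (f : Curve (n := n) x) (φ : Reparam) : Curve (n := n) x where
  toFun := f.toFun ∘ φ.toFun
  map_zero := by simp [φ.map_zero, f.map_zero]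
  holo := by
    refine ContMDiffAt.comp (0 : ℂ) ?_ φ.holo.contDiffAt.contMDiffAt
    rw [φ.map_zero]
    exact f.holo

/-- The derivatives `f'(0), …, f⁽ᵏ⁾(0)` read in the chart `e`: the coordinate indexed by
`(j, i)` is the `i`-th component of the derivative of order `j + 1`. -/
def Curve.coords {x : X} (k : ℕ) (e : OpenPartialHomeomorph X (EuclideanSpace ℂ (Fin n)))
    (f : Curve (n := n) x) : Fin k × Fin n → ℂ :=
  fun p => iteratedDeriv (p.1.val + 1) (e ∘ f.toFun) 0 p.2

/-- Two curves through `x` have the same `k`-jet if their derivatives at `0` up to order `k`,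
read in the chart at `x`, coincide. -/
def jetSetoid (k : ℕ) (x : X) : Setoid (Curve (n := n) x) where
  r f g := ∀ j ≤ k, iteratedDeriv j (chartAt (EuclideanSpace ℂ (Fin n)) x ∘ f.toFun) 0 =
    iteratedDeriv j (chartAt (EuclideanSpace ℂ (Fin n)) x ∘ g.toFun) 0
  iseqv := ⟨fun _ _ _ => rfl, fun h j hj => (h j hj).symm,
    fun h h' j hj => (h j hj).trans (h' j hj)⟩

variable (n) in
/-- The fibre `J_{k,x}` of the bundle of `k`-jets of curves in `X`. -/
def JetSpace (k : ℕ) (x : X) : Type _ := Quotient (jetSetoid (n := n) k x)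

/-- The `k`-jet of a curve. -/
def Curve.jet {x : X} (k : ℕ) (f : Curve (n := n) x) : JetSpace n k x :=
  Quotient.mk (jetSetoid k x) f

/-! ### Jet differentials -/

/-- `Q` is the polynomial `P` in the derivatives read in the chart `e`. -/
def Represents {k : ℕ} {x : X} (e : OpenPartialHomeomorph X (EuclideanSpace ℂ (Fin n)))
    (P : MvPolynomial (Fin k × Fin n) ℂ) (Q : JetSpace n k x → ℂ) : Prop :=
  ∀ f : Curve (n := n) x, Q (f.jet k) = MvPolynomial.eval (f.coords k e) P

variable (n) in
/-- The functions on `J_{k,x}` that are polynomials in the derivatives (read in the chart at `x`)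
with all exponents in `s`. -/
def polyFun (k : ℕ) (x : X) (s : Set (Fin k × Fin n →₀ ℕ)) :
    Submodule ℂ (JetSpace n k x → ℂ) where
  carrier := {Q | ∃ P ∈ MvPolynomial.restrictSupport ℂ s,
    Represents (chartAt (EuclideanSpace ℂ (Fin n)) x) P Q}
  zero_mem' := ⟨0, Submodule.zero_mem _, fun f => by simp⟩
  add_mem' := by
    rintro Q R ⟨P, hP, hQ⟩ ⟨P', hP', hR⟩
    exact ⟨P + P', Submodule.add_mem _ hP hP', fun f => by simp [hQ f, hR f]⟩
  smul_mem' := by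
    rintro c Q ⟨P, hP, hQ⟩
    exact ⟨c • P, Submodule.smul_mem _ c hP, fun f => by simp [hQ f, MvPolynomial.smul_eval]⟩

variable (n) in
/-- The fibre at `x` of the Green–Griffiths bundle `E^{GG}_{k,m} T_X^*`: polynomials
`Q(f', …, f⁽ᵏ⁾)` with `Q(c f', c² f'', …, cᵏ f⁽ᵏ⁾) = c^m Q(f', …, f⁽ᵏ⁾)` for `c ∈ ℂ^*`. -/
def greenGriffiths (k m : ℕ) (x : X) : Submodule ℂ (JetSpace n k x → ℂ) where
  carrier := {Q | Q ∈ polyFun n k x Set.univ ∧ ∀ (f : Curve (n := n) x) (c : ℂ) (hc : c ≠ 0),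
    Q ((f.comp (Reparam.scale c hc)).jet k) = c ^ m * Q (f.jet k)}
  zero_mem' := ⟨Submodule.zero_mem _, by simp⟩
  add_mem' := by
    rintro Q R ⟨hQ, hQ'⟩ ⟨hR, hR'⟩
    exact ⟨Submodule.add_mem _ hQ hR, fun f c hc => by simp [hQ' f c hc, hR' f c hc, mul_add]⟩
  smul_mem' := by
    rintro a Q ⟨hQ, hQ'⟩
    exact ⟨Submodule.smul_mem _ a hQ, fun f c hc => by
      simp [hQ' f c hc, mul_left_comm]⟩

variable (n) in
/-- The fibre at `x` of the bundle `E_{k,m} T_X^*` of invariant jet differentials of order `k`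
and degree `m`. -/
def invJet (k m : ℕ) (x : X) : Submodule ℂ (JetSpace n k x → ℂ) where
  carrier := {Q | Q ∈ greenGriffiths n k m x ∧ ∀ (f : Curve (n := n) x) (φ : Reparam),
    Q ((f.comp φ).jet k) = deriv φ.toFun 0 ^ m * Q (f.jet k)}
  zero_mem' := ⟨Submodule.zero_mem _, by simp⟩
  add_mem' := by
    rintro Q R ⟨hQ, hQ'⟩ ⟨hR, hR'⟩
    exact ⟨Submodule.add_mem _ hQ hR, fun f φ => by simp [hQ' f φ, hR' f φ, mul_add]⟩
  smul_mem' := by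
    rintro a Q ⟨hQ, hQ'⟩
    exact ⟨Submodule.smul_mem _ a hQ, fun f φ => by simp [hQ' f φ, mul_left_comm]⟩

/-! ### The canonical filtration

A polynomial is first filtered by its degree in `f⁽ᵏ⁾`, each quotient is then filtered by the degree
in `f⁽ᵏ⁻¹⁾`, and so on. This is the filtration by the multidegree `(l_1, …, l_k)`, where the
multidegrees are compared lexicographically starting from `l_k`. -/

/-- The multidegree `(l_1, …, l_k)` of a monomial, `l_j` being its degree in the components of
`f⁽ʲ⁾` (stored at the index `j - 1`). -/
def multidegree {k : ℕ} (d : Fin k × Fin n →₀ ℕ) : Fin k → ℕ := fun j => ∑ i, d (j, i)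

/-- The multidegree listed from `l_k` down to `l_1`, with the lexicographic order. -/
def revLex {k : ℕ} (l : Fin k → ℕ) : Lex (Fin k → ℕ) := toLex (fun j => l (Fin.rev j))

variable (n) in
/-- The step `l` of the filtration of `E_{k,m} T_{X,x}^*`. -/
def filtLE (k m : ℕ) (l : Fin k → ℕ) (x : X) : Submodule ℂ (JetSpace n k x → ℂ) :=
  invJet n k m x ⊓ polyFun n k x {d | revLex (multidegree d) ≤ revLex l}

variable (n) in
/-- The part of `E_{k,m} T_{X,x}^*` that lies strictly below the step `l`. -/
def filtLT (k m : ℕ) (l : Fin k → ℕ) (x : X) : Submodule ℂ (JetSpace n k x → ℂ) :=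
  invJet n k m x ⊓ polyFun n k x {d | revLex (multidegree d) < revLex l}

variable (n) in
/-- The fibre at `x` of the graded piece `Gr^l E_{k,m} T_X^*`. -/
abbrev grPiece (k m : ℕ) (l : Fin k → ℕ) (x : X) : Type _ :=
  filtLE n k m l x ⧸ (filtLT n k m l x).submoduleOf (filtLE n k m l x)

/-- The multi-indices with `l_1 + 2 l_2 + … + k l_k = m`. -/
abbrev WeightIndex (k m : ℕ) : Type := {l : Fin k → ℕ // ∑ j, (j.val + 1) * l j = m}

variable (n) in
/-- The fibre at `x` of `Gr^• E_{k,m} T_X^*`. -/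
abbrev GrInvJet (k m : ℕ) (x : X) : Type _ := ⨁ l : WeightIndex k m, grPiece n k m l.1 x

/-! ### Holomorphic sections of the jet bundles -/

/-- A section of `E_{k,m} T_X^*` is holomorphic near `x` if it is given there by a polynomial in the
derivatives, read in a fixed chart, with holomorphic coefficients. -/
def IsHolomorphicJetAt {k : ℕ} (Q : ∀ y : X, JetSpace n k y → ℂ) (x : X) : Prop :=
  ∃ P : X → MvPolynomial (Fin k × Fin n) ℂ,
    (∀ᶠ y in 𝓝 x, Represents (chartAt (EuclideanSpace ℂ (Fin n)) x) (P y) (Q y)) ∧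
    ∀ d, ContMDiffAt 𝓘(ℂ, EuclideanSpace ℂ (Fin n)) 𝓘(ℂ, ℂ) ω (fun y => (P y).coeff d) x

/-- A section of the quotient bundle `Gr^l` is holomorphic near `x` if it lifts there to a
holomorphic section of the step `l` of the filtration. -/
def IsHolomorphicGrPieceAt {k m : ℕ} {l : Fin k → ℕ} (σ : ∀ y : X, grPiece n k m l y) (x : X) :
    Prop :=
  ∃ Q : ∀ y : X, filtLE n k m l y, IsHolomorphicJetAt (fun y => (Q y).1) x ∧
    ∀ᶠ y in 𝓝 x, Submodule.Quotient.mk (Q y) = σ y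

/-- Holomorphy near `x` of a section of `Gr^• E_{k,m} T_X^*`. -/
def IsHolomorphicGrAt {k m : ℕ} (σ : ∀ y : X, GrInvJet n k m y) (x : X) : Prop :=
  ∀ l : WeightIndex k m, IsHolomorphicGrPieceAt (fun y => σ y l) x

end Jets

/-! ### Schur functors -/

section Schur

variable {r : ℕ}

/-- The boxes of the Young diagram with rows of lengths `lam 0 ≥ lam 1 ≥ …`. -/
abbrev Box (lam : Fin r → ℕ) : Type := (i : Fin r) × Fin (lam i)

/-- The permutations of the boxes that preserve every row. -/
def rowPerms (lam : Fin r → ℕ) : Finset (Equiv.Perm (Box lam)) :=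
  Finset.univ.filter fun p => ∀ b, (p b).1 = b.1

/-- The permutations of the boxes that preserve every column. -/
def colPerms (lam : Fin r → ℕ) : Finset (Equiv.Perm (Box lam)) :=
  Finset.univ.filter fun q => ∀ b, (q b).2.val = b.2.val

/-- The Young symmetrizer on `V^{⊗|lam|}`, the factors being indexed by the boxes: antisymmetrize
the columns, then symmetrize the rows. -/
def youngSymmetrizer (lam : Fin r → ℕ) (V : Type*) [AddCommGroup V] [Module ℂ V] :
    (⨂[ℂ] _ : Box lam, V) →ₗ[ℂ] (⨂[ℂ] _ : Box lam, V) :=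
  (∑ p ∈ rowPerms lam, (PiTensorProduct.reindex ℂ (fun _ : Box lam => V) p).toLinearMap) ∘ₗ
  (∑ q ∈ colPerms lam, ((Equiv.Perm.sign q : ℤ) : ℂ) •
    (PiTensorProduct.reindex ℂ (fun _ : Box lam => V) q).toLinearMap)

/-- The Schur power `Γ^lam V`: the image of the Young symmetrizer. -/
def schur (lam : Fin r → ℕ) (V : Type*) [AddCommGroup V] [Module ℂ V] :
    Submodule ℂ (⨂[ℂ] _ : Box lam, V) :=
  LinearMap.range (youngSymmetrizer lam V)

end Schur

/-! ### Schur powers of the cotangent bundle -/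

section Cotangent

variable {n : ℕ} {X : Type*} [TopologicalSpace X] [ChartedSpace (EuclideanSpace ℂ (Fin n)) X]

variable (n) in
/-- The holomorphic cotangent space `T_{X,x}^*`. -/
abbrev Cotangent (x : X) : Type _ :=
  Module.Dual ℂ (TangentSpace 𝓘(ℂ, EuclideanSpace ℂ (Fin n)) x)

/-- The value at `y` of the differential `dz_i` of the `i`-th coordinate of the chart at `x`. -/
def dz (x y : X) (i : Fin n) : Cotangent n y :=
  (EuclideanSpace.proj i : EuclideanSpace ℂ (Fin n) →L[ℂ] ℂ).toLinearMap ∘ₗ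
    (mfderiv 𝓘(ℂ, EuclideanSpace ℂ (Fin n)) 𝓘(ℂ, EuclideanSpace ℂ (Fin n))
      (chartAt (EuclideanSpace ℂ (Fin n)) x) y).toLinearMap

/-- A section of a tensor power of `T_X^*` is holomorphic near `x` if it is there a combination,
with holomorphic coefficients, of the tensors `dz_{a_1} ⊗ ⋯ ⊗ dz_{a_d}`. -/
def IsHolomorphicTensorAt {ι : Type} [Fintype ι] [DecidableEq ι]
    (s : ∀ y : X, ⨂[ℂ] _ : ι, Cotangent n y) (x : X) : Prop :=
  ∃ c : (ι → Fin n) → X → ℂ,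
    (∀ a, ContMDiffAt 𝓘(ℂ, EuclideanSpace ℂ (Fin n)) 𝓘(ℂ, ℂ) ω (c a) x) ∧
    ∀ᶠ y in 𝓝 x, s y = ∑ a, c a y • PiTensorProduct.tprod ℂ (fun b => dz x y (a b))

/-- The triples `(γ, λ₁, λ₂)` with `0 ≤ γ ≤ m/5`, `λ₁ + 2 λ₂ = m - γ`, `λ₁ - λ₂ ≥ γ`, `λ₂ ≥ γ`. -/
structure SchurIndex (m : ℕ) where
  γ : ℕ
  lam₁ : ℕ
  lam₂ : ℕ
  five_mul_le : 5 * γ ≤ m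
  weight : lam₁ + 2 * lam₂ + γ = m
  le_sub : lam₂ + γ ≤ lam₁
  le_lam₂ : γ ≤ lam₂

variable (n) in
/-- The fibre at `x` of `⨁ Γ^{(λ₁, λ₂)} T_X^*`. -/
abbrev SchurSum (m : ℕ) (x : X) : Type _ :=
  ⨁ p : SchurIndex m, schur ![p.lam₁, p.lam₂] (Cotangent n x)

/-- Holomorphy near `x` of a section of `⨁ Γ^{(λ₁, λ₂)} T_X^*`. -/
def IsHolomorphicSchurAt {m : ℕ} (s : ∀ y : X, SchurSum n m y) (x : X) : Prop :=
  ∀ p : SchurIndex m, IsHolomorphicTensorAt (fun y => ((s y p).1)) x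

end Cotangent

end JetDiff

end

noncomputable section

namespace JetDiff

open MvPolynomial

/-! ### Leading parts with respect to the multidegree -/

section Lead

variable {k n : ℕ}

/-! Write u = f', v = f'', t = f''' in a chart. A reparametrization with derivatives a, b, c at 0
acts by (u, v, t) ↦ (au, a²v + bu, a³t + 3abv + cu). This action is linear, so an invariant
polynomial splits into parts of fixed total degree. The weight m being fixed as well, the
multidegrees in such a part lie on a line of direction (1, -2, 1). Let l = (l₁, l₂, l₃) be the
leading one. Rescaling t makes the term 3abv negligible. The leading part is therefore invariant
under v ↦ v + bu and t ↦ t + cu independently (`IsInv.eval_homPart`), and it equals q(u) W₁^{l₂}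
W₂^{l₃}. Here W₁ = u₁v₂ - u₂v₁, W₂ = u₁t₂ - u₂t₁, and q is homogeneous of degree l₁ - l₂ - l₃
(`IsInv.exists_homPart_eq`).

One more constraint holds: a nonzero leading part has deg q ≥ l₃ (`IsInv.homPart_eq_zero`).
Conversely u_i W₂ is the leading part of the invariant `thirdInv i`. Hence, when deg q ≥ l₃, each
factor W₂ can be paired with a factor u_i, and every such q occurs (`isLead_lift`, `isInv_lift`). So
Gr^l is zero, or it is S^{l₁-l₂-l₃} ⊗ det^{l₂+l₃} = Γ^{(l₁, l₂+l₃)}. The dictionary γ = l₃, λ₁ = l₁,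
λ₂ = l₂ + l₃ turns the constraints into those of the theorem.

To compare bundles, both sides are embedded in polynomials in two vectors. On the jet side, setting
t = v in the leading part gives q(u) W₁^{l₂+l₃} (`symbol`). On the Schur side, a row-symmetric
tensor is determined by its polynomial, and the Young symmetrizer becomes a determinant with 2×2
blocks, one for each column of length two. The two images coincide (`exists_fibre_equiv`). A change
of chart is triangular for the multidegree with the Jacobian as its leading substitution
(`exists_chart_change`), and dz₁, dz₂ change by the same matrix. So the identification does not
depend on the chart (`tensorPoly_eq_merge_homPart`). Holomorphic sections correspond because both
passages are constant linear formulas in the coefficients. -/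

theorem multidegree_add (d d' : Fin k × Fin n →₀ ℕ) :
    multidegree (d + d') = multidegree d + multidegree d' := by
  ext j
  simp [multidegree, Finset.sum_add_distrib]

theorem multidegree_zero : multidegree (0 : Fin k × Fin n →₀ ℕ) = 0 := by
  ext j
  simp [multidegree]

theorem multidegree_single (p : Fin k × Fin n) (a : ℕ) :
    multidegree (Finsupp.single p a) = Pi.single p.1 a := by
  ext j
  obtain ⟨j', i'⟩ := p
  by_cases h : j' = j
  · subst h
    simp [multidegree, Finsupp.single_apply]
  · simp [multidegree, Ne.symm h]

theorem revLex_add (l l' : Fin k → ℕ) : revLex (l + l') = revLex l + revLex l' := rfl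

theorem revLex_injective : Function.Injective (revLex (k := k)) := by
  intro l l' h
  ext j
  have := congrFun (toLex.injective h) (Fin.rev j)
  simpa using this

/-- Makes the multidegree a weight with values in `Fin k → ℕ`, so that parts of given multidegree
are weighted homogeneous components. -/
theorem weight_single_fst (d : Fin k × Fin n →₀ ℕ) :
    Finsupp.weight (fun p : Fin k × Fin n => (Pi.single p.1 1 : Fin k → ℕ)) d = multidegree d := by
  induction d using Finsupp.induction_linear with
  | zero => simp [multidegree_zero]
  | add f g hf hg => rw [map_add, hf, hg, multidegree_add]
  | single p a =>
    rw [multidegree_single, Finsupp.weight_single]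
    ext j
    by_cases h : j = p.1
    · subst h; simp
    · simp [h]

/-- The part of multidegree `l` of a polynomial. -/
def homPart (l : Fin k → ℕ) :
    MvPolynomial (Fin k × Fin n) ℂ →ₗ[ℂ] MvPolynomial (Fin k × Fin n) ℂ :=
  weightedHomogeneousComponent (fun p => (Pi.single p.1 1 : Fin k → ℕ)) l

theorem coeff_homPart (l : Fin k → ℕ) (P : MvPolynomial (Fin k × Fin n) ℂ) (d) :
    coeff d (homPart l P) = if multidegree d = l then coeff d P else 0 := by
  rw [homPart, coeff_weightedHomogeneousComponent, weight_single_fst]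

variable (k n) in
/-- Polynomials of multidegree `l`. -/
abbrev homSub (l : Fin k → ℕ) : Submodule ℂ (MvPolynomial (Fin k × Fin n) ℂ) :=
  restrictSupport ℂ {d | multidegree d = l}

variable (k n) in
/-- Polynomials all of whose multidegrees are at most `l`. -/
abbrev leSub (l : Fin k → ℕ) : Submodule ℂ (MvPolynomial (Fin k × Fin n) ℂ) :=
  restrictSupport ℂ {d | revLex (multidegree d) ≤ revLex l}

variable (k n) in
/-- Polynomials all of whose multidegrees are less than `l`. -/
abbrev ltSub (l : Fin k → ℕ) : Submodule ℂ (MvPolynomial (Fin k × Fin n) ℂ) :=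
  restrictSupport ℂ {d | revLex (multidegree d) < revLex l}

theorem mem_restrictSupport_iff_coeff {σ : Type*} {s : Set (σ →₀ ℕ)} {P : MvPolynomial σ ℂ} :
    P ∈ restrictSupport ℂ s ↔ ∀ d, coeff d P ≠ 0 → d ∈ s := by
  rw [mem_restrictSupport_iff]
  simp only [Set.subset_def, Finset.mem_coe, mem_support_iff]

theorem mul_mem_restrictSupport {σ : Type*} {s t u : Set (σ →₀ ℕ)} {P Q : MvPolynomial σ ℂ}
    (hP : P ∈ restrictSupport ℂ s) (hQ : Q ∈ restrictSupport ℂ t)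
    (h : ∀ a ∈ s, ∀ b ∈ t, a + b ∈ u) : P * Q ∈ restrictSupport ℂ u := by
  refine restrictSupport_mono (R := ℂ) (Set.add_subset_iff.2 h) ?_
  rw [restrictSupport_add]
  exact Submodule.mul_mem_mul hP hQ

theorem mul_mem_homSub {l l' : Fin k → ℕ} {P Q : MvPolynomial (Fin k × Fin n) ℂ}
    (hP : P ∈ homSub k n l) (hQ : Q ∈ homSub k n l') : P * Q ∈ homSub k n (l + l') := by
  refine mul_mem_restrictSupport hP hQ fun a ha b hb => ?_
  simp only [Set.mem_ofPred_eq] at *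
  rw [multidegree_add, ha, hb]

theorem mul_mem_ltSub {l l' : Fin k → ℕ} {P Q : MvPolynomial (Fin k × Fin n) ℂ}
    (hP : P ∈ leSub k n l) (hQ : Q ∈ ltSub k n l') : P * Q ∈ ltSub k n (l + l') := by
  refine mul_mem_restrictSupport hP hQ fun a ha b hb => ?_
  simp only [Set.mem_ofPred_eq] at *
  rw [multidegree_add, revLex_add, revLex_add]
  exact add_lt_add_of_le_of_lt ha hb

theorem homSub_le_leSub (l : Fin k → ℕ) : homSub k n l ≤ leSub k n l :=
  restrictSupport_mono _ fun d hd => by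
    simp only [Set.mem_ofPred_eq] at *
    rw [hd]

theorem ltSub_le_leSub (l : Fin k → ℕ) : ltSub k n l ≤ leSub k n l :=
  restrictSupport_mono _ fun _ hd => le_of_lt (α := Lex (Fin k → ℕ)) hd

theorem homPart_mem (l : Fin k → ℕ) (P : MvPolynomial (Fin k × Fin n) ℂ) :
    homPart l P ∈ homSub k n l := by
  rw [mem_restrictSupport_iff_coeff]
  intro d hd
  rw [coeff_homPart] at hd
  by_contra h
  exact hd (if_neg h)

theorem homPart_of_mem {l : Fin k → ℕ} {P : MvPolynomial (Fin k × Fin n) ℂ}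
    (hP : P ∈ homSub k n l) : homPart l P = P := by
  ext d
  rw [coeff_homPart]
  split_ifs with h
  · rfl
  · by_contra h'
    exact h (mem_restrictSupport_iff_coeff.1 hP d (Ne.symm h'))

theorem homPart_of_mem_ltSub {l : Fin k → ℕ} {P : MvPolynomial (Fin k × Fin n) ℂ}
    (hP : P ∈ ltSub k n l) : homPart l P = 0 := by
  ext d
  rw [coeff_homPart, coeff_zero]
  split_ifs with h
  · by_contra h'
    have := mem_restrictSupport_iff_coeff.1 hP d h'
    simp only [Set.mem_ofPred_eq, h] at this
    exact absurd this (lt_irrefl (α := Lex (Fin k → ℕ)) _)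
  · rfl

theorem sub_homPart_mem {l : Fin k → ℕ} {P : MvPolynomial (Fin k × Fin n) ℂ}
    (hP : P ∈ leSub k n l) : P - homPart l P ∈ ltSub k n l := by
  rw [mem_restrictSupport_iff_coeff]
  intro d hd
  rw [coeff_sub, coeff_homPart] at hd
  split_ifs at hd with h
  · simp at hd
  · have := mem_restrictSupport_iff_coeff.1 hP d (by simpa using hd)
    exact lt_of_le_of_ne (α := Lex (Fin k → ℕ)) this fun h' => h (revLex_injective h')

theorem mem_ltSub_of_homPart_eq_zero {l : Fin k → ℕ} {P : MvPolynomial (Fin k × Fin n) ℂ}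
    (hP : P ∈ leSub k n l) (h : homPart l P = 0) : P ∈ ltSub k n l := by
  simpa [h] using sub_homPart_mem hP

theorem leSub_le_ltSub {l l' : Fin k → ℕ} (h : revLex l < revLex l') :
    leSub k n l ≤ ltSub k n l' :=
  restrictSupport_mono _ fun _ hd => lt_of_le_of_lt (α := Lex (Fin k → ℕ)) hd h

/-- `P` has all its multidegrees at most `l` and its part of multidegree `l` is `R`. -/
def IsLead (P : MvPolynomial (Fin k × Fin n) ℂ) (l : Fin k → ℕ)
    (R : MvPolynomial (Fin k × Fin n) ℂ) : Prop :=
  R ∈ homSub k n l ∧ P - R ∈ ltSub k n l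

theorem IsLead.mem_leSub {P R : MvPolynomial (Fin k × Fin n) ℂ} {l : Fin k → ℕ}
    (h : IsLead P l R) : P ∈ leSub k n l := by
  have := Submodule.add_mem _ (ltSub_le_leSub l h.2) (homSub_le_leSub l h.1)
  simpa using this

theorem IsLead.homPart_eq {P R : MvPolynomial (Fin k × Fin n) ℂ} {l : Fin k → ℕ}
    (h : IsLead P l R) : homPart l P = R := by
  have h1 := homPart_of_mem_ltSub h.2
  rw [map_sub, homPart_of_mem h.1] at h1
  exact sub_eq_zero.1 h1

theorem isLead_homPart {P : MvPolynomial (Fin k × Fin n) ℂ} {l : Fin k → ℕ}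
    (h : P ∈ leSub k n l) : IsLead P l (homPart l P) :=
  ⟨homPart_mem l P, sub_homPart_mem h⟩

theorem isLead_of_mem {P : MvPolynomial (Fin k × Fin n) ℂ} {l : Fin k → ℕ}
    (h : P ∈ homSub k n l) : IsLead P l P :=
  ⟨h, by simp⟩

theorem IsLead.mul {P R P' R' : MvPolynomial (Fin k × Fin n) ℂ} {l l' : Fin k → ℕ}
    (h : IsLead P l R) (h' : IsLead P' l' R') : IsLead (P * P') (l + l') (R * R') := by
  refine ⟨mul_mem_homSub h.1 h'.1, ?_⟩
  have h1 := mul_mem_ltSub h.mem_leSub h'.2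
  have h2 := mul_mem_ltSub (homSub_le_leSub _ h'.1) h.2
  rw [add_comm l' l] at h2
  have := Submodule.add_mem _ h1 h2
  convert this using 1
  ring

theorem one_mem_homSub : (1 : MvPolynomial (Fin k × Fin n) ℂ) ∈ homSub k n 0 := by
  have : (1 : MvPolynomial (Fin k × Fin n) ℂ) = monomial 0 1 := rfl
  rw [this, monomial_mem_restrictSupport]
  exact Or.inl multidegree_zero

theorem X_mem_homSub (p : Fin k × Fin n) :
    (X p : MvPolynomial (Fin k × Fin n) ℂ) ∈ homSub k n (Pi.single p.1 1) := by
  rw [X, monomial_mem_restrictSupport]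
  exact Or.inl (multidegree_single p 1)

theorem IsLead.pow {P R : MvPolynomial (Fin k × Fin n) ℂ} {l : Fin k → ℕ}
    (h : IsLead P l R) (a : ℕ) : IsLead (P ^ a) (a • l) (R ^ a) := by
  induction a with
  | zero => simpa using isLead_of_mem one_mem_homSub
  | succ a ih => simpa [pow_succ, add_smul] using ih.mul h

theorem IsLead.prod {ι : Type*} (s : Finset ι) {P R : ι → MvPolynomial (Fin k × Fin n) ℂ}
    {l : ι → Fin k → ℕ} (h : ∀ i ∈ s, IsLead (P i) (l i) (R i)) :
    IsLead (∏ i ∈ s, P i) (∑ i ∈ s, l i) (∏ i ∈ s, R i) := by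
  classical
  induction s using Finset.induction_on with
  | empty => simpa using isLead_of_mem one_mem_homSub
  | insert i s hi ih =>
    rw [Finset.prod_insert hi, Finset.prod_insert hi, Finset.sum_insert hi]
    exact (h i (Finset.mem_insert_self i s)).mul
      (ih fun j hj => h j (Finset.mem_insert_of_mem hj))

theorem IsLead.smul {P R : MvPolynomial (Fin k × Fin n) ℂ} {l : Fin k → ℕ}
    (h : IsLead P l R) (a : ℂ) : IsLead (a • P) l (a • R) :=
  ⟨Submodule.smul_mem _ _ h.1, by rw [← smul_sub]; exact Submodule.smul_mem _ _ h.2⟩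

theorem IsLead.sum {ι : Type*} (s : Finset ι) {P R : ι → MvPolynomial (Fin k × Fin n) ℂ}
    {l : Fin k → ℕ} (h : ∀ i ∈ s, IsLead (P i) l (R i)) :
    IsLead (∑ i ∈ s, P i) l (∑ i ∈ s, R i) :=
  ⟨Submodule.sum_mem _ fun i hi => (h i hi).1, by
    rw [← Finset.sum_sub_distrib]
    exact Submodule.sum_mem _ fun i hi => (h i hi).2⟩

theorem multidegree_eq_sum (d : Fin k × Fin n →₀ ℕ) :
    multidegree d = ∑ p : Fin k × Fin n, d p • (Pi.single p.1 1 : Fin k → ℕ) := by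
  rw [← weight_single_fst, Finsupp.weight_apply, Finsupp.sum_fintype]
  simp

/-- A substitution that is triangular for the multidegree respects leading parts. -/
theorem IsLead.bind₁ {P R : MvPolynomial (Fin k × Fin n) ℂ} {l : Fin k → ℕ}
    {Θ A : Fin k × Fin n → MvPolynomial (Fin k × Fin n) ℂ}
    (hΘ : ∀ p, IsLead (Θ p) (Pi.single p.1 1) (A p)) (h : IsLead P l R) :
    IsLead (MvPolynomial.bind₁ Θ P) l (MvPolynomial.bind₁ A R) := by
  have hmon : ∀ (d : Fin k × Fin n →₀ ℕ) (a : ℂ),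
      IsLead (MvPolynomial.bind₁ Θ (monomial d a)) (multidegree d)
        (MvPolynomial.bind₁ A (monomial d a)) := by
    intro d a
    rw [bind₁_monomial, bind₁_monomial, ← smul_eq_C_mul, ← smul_eq_C_mul]
    refine IsLead.smul ?_ a
    rw [Finset.prod_subset (Finset.subset_univ d.support) fun p _ hp => by
        rw [Finsupp.notMem_support_iff.1 hp, pow_zero],
      Finset.prod_subset (Finset.subset_univ d.support) fun p _ hp => by
        rw [Finsupp.notMem_support_iff.1 hp, pow_zero], multidegree_eq_sum]
    exact IsLead.prod _ fun p _ => (hΘ p).pow _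
  have h1 : IsLead (MvPolynomial.bind₁ Θ R) l (MvPolynomial.bind₁ A R) := by
    rw [R.as_sum, map_sum, map_sum]
    refine IsLead.sum _ fun d hd => ?_
    have := mem_restrictSupport_iff_coeff.1 h.1 d (mem_support_iff.1 hd)
    rw [← show multidegree d = l from this]
    exact hmon d _
  -- Each monomial of P - R is sent below its own multidegree or to it, hence strictly below l.
  have h2 : MvPolynomial.bind₁ Θ (P - R) ∈ ltSub k n l := by
    rw [(P - R).as_sum, map_sum]
    refine Submodule.sum_mem _ fun d hd => ?_
    exact leSub_le_ltSub (mem_restrictSupport_iff_coeff.1 h.2 d (mem_support_iff.1 hd))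
      (hmon d _).mem_leSub
  refine ⟨h1.1, ?_⟩
  have := Submodule.add_mem _ h1.2 h2
  rw [map_sub] at this
  convert this using 1
  ring

/-- Rescaling the derivatives of each order. -/
theorem eval_smul_of_mem_homSub {l : Fin k → ℕ} {R : MvPolynomial (Fin k × Fin n) ℂ}
    (hR : R ∈ homSub k n l) (a : Fin k → ℂ) (x : Fin k × Fin n → ℂ) :
    eval (fun p => a p.1 * x p) R = (∏ j, a j ^ l j) * eval x R := by
  rw [eval_eq', eval_eq', Finset.mul_sum]
  refine Finset.sum_congr rfl fun d hd => ?_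
  have hd' : multidegree d = l := mem_restrictSupport_iff_coeff.1 hR d (mem_support_iff.1 hd)
  have : ∏ p : Fin k × Fin n, a p.1 ^ d p = ∏ j, a j ^ l j := by
    rw [Fintype.prod_prod_type]
    refine Finset.prod_congr rfl fun j _ => ?_
    rw [← hd', multidegree, ← Finset.prod_pow_eq_pow_sum]
  simp only [mul_pow, Finset.prod_mul_distrib, this]
  ring

/-- The multidegrees that occur in a polynomial. -/
def multidegrees (P : MvPolynomial (Fin k × Fin n) ℂ) : Finset (Fin k → ℕ) :=
  P.support.image multidegree

theorem sum_homPart (P : MvPolynomial (Fin k × Fin n) ℂ) :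
    ∑ l ∈ multidegrees P, homPart l P = P := by
  ext d
  simp only [coeff_sum, coeff_homPart]
  rw [Finset.sum_ite_eq]
  split_ifs with h
  · rfl
  · by_contra h'
    exact h (Finset.mem_image_of_mem _ (mem_support_iff.2 (Ne.symm h')))

theorem homPart_eq_zero_of_notMem {l : Fin k → ℕ} {P : MvPolynomial (Fin k × Fin n) ℂ}
    (h : l ∉ multidegrees P) : homPart l P = 0 := by
  ext d
  rw [coeff_homPart, coeff_zero]
  split_ifs with h'
  · by_contra h''
    exact h (h' ▸ Finset.mem_image_of_mem _ (mem_support_iff.2 h''))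
  · rfl

end Lead

/-! ### Invariant polynomials -/

section Invariant

theorem multidegree_of_mem_multidegrees {k n : ℕ} {P : MvPolynomial (Fin k × Fin n) ℂ}
    {s : Set (Fin k × Fin n →₀ ℕ)} (hP : P ∈ restrictSupport ℂ s) {l : Fin k → ℕ}
    (hl : l ∈ multidegrees P) : ∃ d ∈ s, multidegree d = l := by
  obtain ⟨d, hd, rfl⟩ := Finset.mem_image.1 hl
  exact ⟨d, mem_restrictSupport_iff_coeff.1 hP d (mem_support_iff.1 hd), rfl⟩

theorem homPart_ne_zero_of_mem {k n : ℕ} {P : MvPolynomial (Fin k × Fin n) ℂ}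
    {l : Fin k → ℕ} (hl : l ∈ multidegrees P) : homPart l P ≠ 0 := by
  obtain ⟨d, hd, rfl⟩ := Finset.mem_image.1 hl
  intro h
  have := congrArg (coeff d) h
  rw [coeff_homPart, if_pos rfl] at this
  exact mem_support_iff.1 hd this

theorem homPart_sum_homPart {k n : ℕ} (P : MvPolynomial (Fin k × Fin n) ℂ) (l : Fin k → ℕ)
    (T : Finset (Fin k → ℕ)) :
    homPart l (∑ l' ∈ T, homPart l' P) = if l ∈ T then homPart l P else 0 := by
  ext d
  rw [coeff_homPart, coeff_sum]
  simp only [coeff_homPart, Finset.sum_ite_eq]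
  by_cases h : multidegree d = l
  · subst h
    by_cases h' : multidegree d ∈ T <;> simp [h', coeff_homPart]
  · by_cases h' : l ∈ T <;> simp [h, h', coeff_homPart]

theorem eval_smul_eq_sum {k n : ℕ} (P : MvPolynomial (Fin k × Fin n) ℂ) (a : Fin k → ℂ)
    (x : Fin k × Fin n → ℂ) :
    eval (fun p => a p.1 * x p) P =
      ∑ l ∈ multidegrees P, (∏ j, a j ^ l j) * eval x (homPart l P) := by
  conv_lhs => rw [← sum_homPart P]
  rw [map_sum]
  exact Finset.sum_congr rfl fun l _ => eval_smul_of_mem_homSub (homPart_mem l P) a x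

/-- Comparison of the coefficients of two polynomial functions of one variable. -/
theorem sum_filter_eq_of_forall_ne_zero {ι : Type*} (S : Finset ι) (e e' : ι → ℕ) (f g : ι → ℂ)
    (h : ∀ c : ℂ, c ≠ 0 → ∑ i ∈ S, c ^ e i * f i = ∑ i ∈ S, c ^ e' i * g i) (N : ℕ) :
    ∑ i ∈ S with e i = N, f i = ∑ i ∈ S with e' i = N, g i := by
  have key : (∑ i ∈ S, Polynomial.C (f i) * Polynomial.X ^ e i : Polynomial ℂ) =
      ∑ i ∈ S, Polynomial.C (g i) * Polynomial.X ^ e' i := by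
    refine Polynomial.eq_of_infinite_eval_eq _ _ (Set.Infinite.mono (s := {0}ᶜ) ?_ ?_)
    · intro c hc
      have := h c hc
      simp only [Set.mem_ofPred_eq, Polynomial.eval_finsetSum, Polynomial.eval_mul,
        Polynomial.eval_C, Polynomial.eval_pow, Polynomial.eval_X]
      simpa only [mul_comm] using this
    · exact Set.Finite.infinite_compl (Set.finite_singleton 0)
  have := congrArg (fun p => Polynomial.coeff p N) key
  simp only [Polynomial.finsetSum_coeff, Polynomial.coeff_C_mul_X_pow] at this
  rw [Finset.sum_filter, Finset.sum_filter]
  simpa only [eq_comm] using this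

/-- The action of the `3`-jet of a reparametrization with derivatives `a, b, c` at `0`. -/
def act (a b c : ℂ) (x : Fin 3 × Fin 2 → ℂ) : Fin 3 × Fin 2 → ℂ := fun p =>
  ![a * x (0, p.2), a ^ 2 * x (1, p.2) + b * x (0, p.2),
    a ^ 3 * x (2, p.2) + 3 * a * b * x (1, p.2) + c * x (0, p.2)] p.1

/-- Polynomials in the `3`-jet that are multiplied by `a ^ m` under reparametrization. -/
def IsInv (m : ℕ) (P : MvPolynomial (Fin 3 × Fin 2) ℂ) : Prop :=
  ∀ (a b c : ℂ), a ≠ 0 → ∀ x, eval (act a b c x) P = a ^ m * eval x P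

/-- The point with `f' = u`, `f'' = v`, `f''' = t`. -/
def pt (u v t : Fin 2 → ℂ) : Fin 3 × Fin 2 → ℂ := fun p => ![u, v, t] p.1 p.2

theorem act_pt (b c : ℂ) (u v t : Fin 2 → ℂ) :
    act 1 b c (pt u v t) = pt u (v + b • u) (t + (3 * b) • v + c • u) := by
  funext ⟨j, i⟩
  fin_cases j <;> simp [act, pt]

theorem pt_eta (x : Fin 3 × Fin 2 → ℂ) :
    pt (fun i => x (0, i)) (fun i => x (1, i)) (fun i => x (2, i)) = x := by
  funext ⟨j, i⟩
  fin_cases j <;> rfl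

theorem eval_pt_smul {l : Fin 3 → ℕ} {R : MvPolynomial (Fin 3 × Fin 2) ℂ}
    (hR : R ∈ homSub 3 2 l) (a b c : ℂ) (u v t : Fin 2 → ℂ) :
    eval (pt (a • u) (b • v) (c • t)) R =
      a ^ l 0 * b ^ l 1 * c ^ l 2 * eval (pt u v t) R := by
  have := eval_smul_of_mem_homSub hR ![a, b, c] (pt u v t)
  rw [Fin.prod_univ_three] at this
  simp only [Matrix.cons_val_zero, Matrix.cons_val_one, Matrix.cons_val] at this
  rw [← this]
  congr 1
  congr 1
  funext ⟨j, i⟩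
  fin_cases j <;> simp [pt]

/-- Only the dilations are needed: compare the powers of c on both sides of the invariance. -/
theorem IsInv.weight {m : ℕ} {P : MvPolynomial (Fin 3 × Fin 2) ℂ} (h : IsInv m P)
    {l : Fin 3 → ℕ} (hl : homPart l P ≠ 0) : l 0 + 2 * l 1 + 3 * l 2 = m := by
  by_contra hm
  apply hl
  have hS : l ∈ multidegrees P := by
    by_contra h'
    exact hl (homPart_eq_zero_of_notMem h')
  have key : ∑ l' ∈ multidegrees P with l' 0 + 2 * l' 1 + 3 * l' 2 = l 0 + 2 * l 1 + 3 * l 2,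
      homPart l' P = 0 := by
    refine MvPolynomial.funext fun x => ?_
    rw [map_sum, map_zero]
    rw [sum_filter_eq_of_forall_ne_zero (multidegrees P)
      (fun l' => l' 0 + 2 * l' 1 + 3 * l' 2) (fun _ => m) (fun l' => eval x (homPart l' P))
      (fun l' => eval x (homPart l' P)) _ (l 0 + 2 * l 1 + 3 * l 2)]
    · rw [Finset.filter_false_of_mem (fun _ _ => Ne.symm hm), Finset.sum_empty]
    · intro c hc
      have h1 := h c 0 0 hc x
      have h2 := eval_smul_eq_sum P ![c, c ^ 2, c ^ 3] x
      have h3 : act c 0 0 x = fun p => ![c, c ^ 2, c ^ 3] p.1 * x p := by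
        funext ⟨j, i⟩
        fin_cases j <;> simp [act]
      rw [h3, h2] at h1
      conv_rhs at h1 => rw [← sum_homPart P, map_sum, Finset.mul_sum]
      rw [← h1]
      refine Finset.sum_congr rfl fun l' _ => ?_
      rw [Fin.prod_univ_three]
      simp only [Matrix.cons_val_zero, Matrix.cons_val_one, Matrix.cons_val]
      ring
  have := homPart_sum_homPart P l
    ({l' ∈ multidegrees P | l' 0 + 2 * l' 1 + 3 * l' 2 = l 0 + 2 * l 1 + 3 * l 2})
  rw [key, map_zero, if_pos (by simp [hS])] at this
  exact this.symm

/-- The multidegrees of total degree `N` that occur in `P`. -/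
def degPart (N : ℕ) (P : MvPolynomial (Fin 3 × Fin 2) ℂ) : Finset (Fin 3 → ℕ) :=
  {l ∈ multidegrees P | l 0 + l 1 + l 2 = N}

/-- The action commutes with multiplication of the whole jet by a scalar s, so invariance can be
compared power by power in s. -/
theorem IsInv.sum_degPart {m : ℕ} {P : MvPolynomial (Fin 3 × Fin 2) ℂ} (h : IsInv m P) (N : ℕ)
    (b c : ℂ) (x : Fin 3 × Fin 2 → ℂ) :
    ∑ l ∈ degPart N P, eval (act 1 b c x) (homPart l P) =
      ∑ l ∈ degPart N P, eval x (homPart l P) := by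
  refine sum_filter_eq_of_forall_ne_zero (multidegrees P) (fun l => l 0 + l 1 + l 2)
    (fun l => l 0 + l 1 + l 2) _ _ (fun s _ => ?_) N
  have h1 := eval_smul_eq_sum P ![s, s, s] (act 1 b c x)
  have h2 := eval_smul_eq_sum P ![s, s, s] x
  have h3 : (fun p : Fin 3 × Fin 2 => ![s, s, s] p.1 * act 1 b c x p) =
      act 1 b c (fun p => ![s, s, s] p.1 * x p) := by
    funext ⟨j, i⟩
    fin_cases j <;> simp [act] <;> ring
  rw [h3, h 1 b c one_ne_zero, one_pow, one_mul, h2] at h1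
  simp only [Fin.prod_univ_three, Matrix.cons_val_zero, Matrix.cons_val_one,
    Matrix.cons_val, ← pow_add] at h1
  exact h1.symm

theorem le_of_revLex_le {l l' : Fin 3 → ℕ} (h : revLex l' ≤ revLex l) : l' 2 ≤ l 2 := by
  by_contra hlt
  push Not at hlt
  refine absurd h (not_le_of_gt (α := Lex (Fin 3 → ℕ)) ?_)
  -- Index 0 of `revLex l` is `l 2`, the first entry compared.
  exact ⟨0, fun j hj => absurd hj (by simp), by simpa [revLex] using hlt⟩

/-- Fixed weight and fixed total degree are two linear equations on three exponents. What remains is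
a line, parametrized by `l' 2`, and `l` sits at its top. -/
theorem mem_degPart {m : ℕ} {P : MvPolynomial (Fin 3 × Fin 2) ℂ} (h : IsInv m P)
    {l : Fin 3 → ℕ} (hP : P ∈ leSub 3 2 l) (hl : l 0 + 2 * l 1 + 3 * l 2 = m) {l' : Fin 3 → ℕ}
    (hl' : l' ∈ degPart (l 0 + l 1 + l 2) P) :
    l' 2 ≤ l 2 ∧ l' 1 + 2 * l' 2 = l 1 + 2 * l 2 ∧ l' 0 + l 2 = l 0 + l' 2 := by
  obtain ⟨h1, h2⟩ := Finset.mem_filter.1 hl'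
  have h3 := h.weight (homPart_ne_zero_of_mem h1)
  obtain ⟨d, hd, rfl⟩ := multidegree_of_mem_multidegrees hP h1
  have := le_of_revLex_le hd
  omega

theorem eq_of_mem_degPart {m : ℕ} {P : MvPolynomial (Fin 3 × Fin 2) ℂ} (h : IsInv m P)
    {l : Fin 3 → ℕ} (hP : P ∈ leSub 3 2 l) (hl : l 0 + 2 * l 1 + 3 * l 2 = m) {l' : Fin 3 → ℕ}
    (hl' : l' ∈ degPart (l 0 + l 1 + l 2) P) (h2 : l' 2 = l 2) : l' = l := by
  obtain ⟨h3, h4, h5⟩ := mem_degPart h hP hl hl'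
  ext j
  fin_cases j
  · change l' 0 = l 0; omega
  · change l' 1 = l 1; omega
  · exact h2

/-- The condition on `f` covers the case where `l` does not occur in `P`, so that the filtered sum
is empty. -/
theorem sum_degPart_filter {m : ℕ} {P : MvPolynomial (Fin 3 × Fin 2) ℂ} (h : IsInv m P)
    {l : Fin 3 → ℕ} (hP : P ∈ leSub 3 2 l) (hl : l 0 + 2 * l 1 + 3 * l 2 = m)
    (f : (Fin 3 → ℕ) → ℂ) (hf : homPart l P = 0 → f l = 0) :
    ∑ l' ∈ degPart (l 0 + l 1 + l 2) P with l' 2 = l 2, f l' = f l := by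
  have : ({l' ∈ degPart (l 0 + l 1 + l 2) P | l' 2 = l 2}) ⊆ {l} := by
    intro l' hl'
    obtain ⟨h1, h2⟩ := Finset.mem_filter.1 hl'
    exact Finset.mem_singleton.2 (eq_of_mem_degPart h hP hl h1 h2)
  rw [Finset.sum_subset this, Finset.sum_singleton]
  intro l' h1 h2
  obtain rfl := Finset.mem_singleton.1 h1
  apply hf
  by_contra h0
  apply h2
  refine Finset.mem_filter.2 ⟨Finset.mem_filter.2 ⟨?_, rfl⟩, rfl⟩
  by_contra h'
  exact h0 (homPart_eq_zero_of_notMem h')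

/-- The leading part of an invariant polynomial is invariant under more substitutions. -/
theorem IsInv.eval_homPart {m : ℕ} {P : MvPolynomial (Fin 3 × Fin 2) ℂ} (h : IsInv m P)
    {l : Fin 3 → ℕ} (hP : P ∈ leSub 3 2 l) (hl : l 0 + 2 * l 1 + 3 * l 2 = m)
    (u v t : Fin 2 → ℂ) (b c : ℂ) :
    eval (pt u (v + b • u) (t + c • u)) (homPart l P) = eval (pt u v t) (homPart l P) := by
  set T := degPart (l 0 + l 1 + l 2) P with hT
  -- Invariance is applied at t/μ with c/μ in place of c, then multiplied by μ^(l 2). The result is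
  -- polynomial in μ, so it extends to μ = 0, where the shear of t along v disappears.
  let G : ℂ → ℂ := fun μ => ∑ l' ∈ T, μ ^ (l 2 - l' 2) *
    eval (pt u (v + b • u) (t + c • u + (3 * b * μ) • v)) (homPart l' P)
  let H : ℂ → ℂ := fun μ => ∑ l' ∈ T, μ ^ (l 2 - l' 2) * eval (pt u v t) (homPart l' P)
  have hGc : Continuous G := by
    refine continuous_finsetSum _ fun l' _ => ?_
    refine Continuous.mul (by fun_prop) ((MvPolynomial.continuous_eval _).comp ?_)
    refine continuous_pi fun ⟨j, i⟩ => ?_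
    fin_cases j <;> simp [pt] <;> fun_prop
  have hHc : Continuous H := by fun_prop
  have hGH : G = H := by
    refine Continuous.ext_on (s := {0}ᶜ) (dense_compl_singleton 0) hGc hHc fun μ hμ => ?_
    have hμ : μ ≠ 0 := hμ
    have key := h.sum_degPart (l 0 + l 1 + l 2) b (μ⁻¹ * c) (pt u v (μ⁻¹ • t))
    rw [act_pt] at key
    have e1 : μ⁻¹ • t + (3 * b) • v + (μ⁻¹ * c) • u =
        μ⁻¹ • (t + c • u + (3 * b * μ) • v) := by
      ext i
      simp only [Pi.add_apply, Pi.smul_apply, smul_eq_mul]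
      field_simp
      ring
    have e2 : ∀ (v' t' : Fin 2 → ℂ), ∀ l' ∈ T, eval (pt u v' (μ⁻¹ • t')) (homPart l' P) =
        (μ ^ l 2)⁻¹ * (μ ^ (l 2 - l' 2) * eval (pt u v' t') (homPart l' P)) := by
      intro v' t' l' hl'
      have h1 := eval_pt_smul (homPart_mem l' P) 1 1 μ⁻¹ u v' t'
      simp only [one_smul, one_pow, one_mul] at h1
      rw [h1, ← mul_assoc]
      congr 1
      have hle := (mem_degPart h hP hl hl').1
      rw [inv_pow, ← div_eq_inv_mul, eq_div_iff (pow_ne_zero _ hμ), ← div_eq_inv_mul,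
        div_eq_iff (pow_ne_zero _ hμ), ← pow_add, Nat.sub_add_cancel hle]
    rw [e1, Finset.sum_congr rfl (e2 _ _), Finset.sum_congr rfl (e2 _ _), ← Finset.mul_sum,
      ← Finset.mul_sum] at key
    exact mul_left_cancel₀ (inv_ne_zero (pow_ne_zero _ hμ)) key
  have h0 := congrFun hGH 0
  -- At μ = 0 the factor 0^(l 2 - l' 2) keeps only l' 2 = l 2, that is, l' = l.
  have hz : ∀ f : (Fin 3 → ℕ) → ℂ, (homPart l P = 0 → f l = 0) →
      ∑ l' ∈ T, (0 : ℂ) ^ (l 2 - l' 2) * f l' = f l := by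
    intro f hf
    rw [← sum_degPart_filter h hP hl f hf, Finset.sum_filter]
    refine Finset.sum_congr rfl fun l' hl' => ?_
    have hle := (mem_degPart h hP hl hl').1
    split_ifs with h2
    · simp [h2]
    · rw [zero_pow (by omega), zero_mul]
  simp only [G, H] at h0
  rw [hz (fun l' => eval _ (homPart l' P)) (fun h' => by simp [h']),
    hz (fun l' => eval _ (homPart l' P)) (fun h' => by simp [h'])] at h0
  simpa using h0

/-- The two independent shears along u bring v and t to multiples of (0, 1), the factors being the
Wronskians divided by u₁. Homogeneity then takes these factors out. -/
theorem IsInv.eval_homPart_eq {m : ℕ} {P : MvPolynomial (Fin 3 × Fin 2) ℂ} (h : IsInv m P)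
    {l : Fin 3 → ℕ} (hP : P ∈ leSub 3 2 l) (hl : l 0 + 2 * l 1 + 3 * l 2 = m)
    (u v t : Fin 2 → ℂ) (hu : u 0 ≠ 0) :
    u 0 ^ (l 1 + l 2) * eval (pt u v t) (homPart l P) =
      (u 0 * v 1 - u 1 * v 0) ^ l 1 * (u 0 * t 1 - u 1 * t 0) ^ l 2 *
        eval (pt u ![0, 1] ![0, 1]) (homPart l P) := by
  have h1 := h.eval_homPart hP hl u v t (-(v 0 / u 0)) (-(t 0 / u 0))
  have h2 := eval_pt_smul (homPart_mem l P) 1 ((u 0 * v 1 - u 1 * v 0) / u 0)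
    ((u 0 * t 1 - u 1 * t 0) / u 0) u ![0, 1] ![0, 1]
  have e : ∀ v : Fin 2 → ℂ, v + (-(v 0 / u 0)) • u =
      ((u 0 * v 1 - u 1 * v 0) / u 0) • ![0, 1] := by
    intro v
    ext i
    fin_cases i
    · simp [hu]
    · simp
      field_simp
      ring
  rw [e, e] at h1
  rw [one_smul, h1] at h2
  rw [h2, one_pow, one_mul, div_pow, div_pow, pow_add]
  field_simp

theorem eval_aeval_polynomial {σ : Type*} (g : σ → Polynomial ℂ) (R : MvPolynomial σ ℂ) (s : ℂ) :
    (aeval g R).eval s = eval (fun p => (g p).eval s) R := by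
  induction R using MvPolynomial.induction_on with
  | C a => simp
  | add p q hp hq => simp [hp, hq]
  | mul_X p i hp => simp [hp]

theorem natDegree_aeval_le {l : Fin 3 → ℕ} {R : MvPolynomial (Fin 3 × Fin 2) ℂ}
    (hR : R ∈ homSub 3 2 l) (g : Fin 3 × Fin 2 → Polynomial ℂ)
    (h0 : ∀ i, (g (0, i)).natDegree ≤ 1) (h1 : ∀ i, (g (1, i)).natDegree = 0)
    (h2 : ∀ i, (g (2, i)).natDegree = 0) : (aeval g R).natDegree ≤ l 0 := by
  rw [R.as_sum, map_sum]
  refine Polynomial.natDegree_sum_le_of_forall_le _ _ fun d hd => ?_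
  have hd' : multidegree d = l := mem_restrictSupport_iff_coeff.1 hR d (mem_support_iff.1 hd)
  rw [aeval_monomial, Finsupp.prod_fintype _ _ (by simp)]
  refine (Polynomial.natDegree_C_mul_le _ _).trans ((Polynomial.natDegree_prod_le _ _).trans ?_)
  have : ∀ p : Fin 3 × Fin 2, (g p ^ d p).natDegree ≤ if p.1 = 0 then d p else 0 := by
    rintro ⟨j, i⟩
    refine Polynomial.natDegree_pow_le.trans ?_
    fin_cases j
    · simpa using Nat.mul_le_mul_left (d (0, i)) (h0 i)
    · simp [h1]
    · simp [h2]
  refine (Finset.sum_le_sum fun p _ => this p).trans ?_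
  rw [← hd', Fintype.sum_prod_type, Fin.sum_univ_three]
  simp [multidegree]

/-- At t = 0, u = (1, s - ε), v = (1, s), only the terms with `l' 2 = 0` survive, and their degree
in ε is at most l 0 - l 2. After the reparametrization of `key`, the same quantity is divisible by
ε^(l 1 + l 2). If l 0 < l 1 + 2 l 2 it must vanish, and its expansion in ε then forces the leading
part to vanish. -/
theorem IsInv.homPart_eq_zero {m : ℕ} {P : MvPolynomial (Fin 3 × Fin 2) ℂ} (h : IsInv m P)
    {l : Fin 3 → ℕ} (hP : P ∈ leSub 3 2 l) (hl : l 0 + 2 * l 1 + 3 * l 2 = m)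
    (hlt : l 0 < l 1 + 2 * l 2) : homPart l P = 0 := by
  set T := degPart (l 0 + l 1 + l 2) P with hT
  -- With b = -1 and c = 3, v becomes v - u = (0, ε) and t = 0 becomes -3v + 3u = (0, -3ε).
  have key : ∀ s ε : ℂ, ∑ l' ∈ T, eval (pt ![1, s - ε] ![1, s] 0) (homPart l' P) =
      ∑ l' ∈ T, ε ^ l' 1 * (-3 * ε) ^ l' 2 *
        eval (pt ![1, s - ε] ![0, 1] ![0, 1]) (homPart l' P) := by
    intro s ε
    have h1 := h.sum_degPart (l 0 + l 1 + l 2) (-1) 3 (pt ![1, s - ε] ![1, s] 0)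
    rw [act_pt] at h1
    rw [← hT] at h1
    rw [← h1]
    refine Finset.sum_congr rfl fun l' _ => ?_
    have h2 := eval_pt_smul (homPart_mem l' P) 1 ε (-3 * ε) ![1, s - ε] ![0, 1] ![0, 1]
    rw [one_pow, one_mul, one_smul] at h2
    rw [← h2]
    congr 2
    congr 1
    · ext i
      fin_cases i <;> simp
    · ext i
      fin_cases i <;> simp
      ring
  have hzero : ∀ s ε : ℂ, ∑ l' ∈ T, eval (pt ![1, s - ε] ![1, s] 0) (homPart l' P) = 0 := by
    intro s
    let g : Fin 3 × Fin 2 → Polynomial ℂ := fun p =>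
      ![![1, Polynomial.C s - Polynomial.X], ![1, Polynomial.C s], 0] p.1 p.2
    let g' : Fin 3 × Fin 2 → Polynomial ℂ := fun p =>
      ![![1, Polynomial.C s - Polynomial.X], ![0, 1], ![0, 1]] p.1 p.2
    have hg : ∀ ε, (fun p => (g p).eval ε) = pt ![1, s - ε] ![1, s] 0 := by
      intro ε
      funext ⟨j, i⟩
      fin_cases j <;> fin_cases i <;> simp [g, pt]
    have hg' : ∀ ε, (fun p => (g' p).eval ε) = pt ![1, s - ε] ![0, 1] ![0, 1] := by
      intro ε
      funext ⟨j, i⟩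
      fin_cases j <;> fin_cases i <;> simp [g', pt]
    have hpoly : ∑ l' ∈ T, aeval g (homPart l' P) = ∑ l' ∈ T, Polynomial.X ^ l' 1 *
        (-3 * Polynomial.X) ^ l' 2 * aeval g' (homPart l' P) := by
      refine Polynomial.funext fun ε => ?_
      have := key s ε
      rw [← hg, ← hg'] at this
      simp only [Polynomial.eval_finsetSum, eval_aeval_polynomial, Polynomial.eval_mul,
        Polynomial.eval_pow, Polynomial.eval_X, Polynomial.eval_neg, Polynomial.eval_ofNat]
      exact this
    -- On the line of `mem_degPart`, l' 1 + l' 2 = l 1 + 2 l 2 - l' 2 ≥ l 1 + l 2.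
    have hdvd : (Polynomial.X : Polynomial ℂ) ^ (l 1 + l 2) ∣
        ∑ l' ∈ T, aeval g (homPart l' P) := by
      rw [hpoly]
      refine Finset.dvd_sum fun l' hl' => Dvd.dvd.mul_right ?_ _
      obtain ⟨h3, h4, h5⟩ := mem_degPart h hP hl hl'
      rw [mul_pow, mul_left_comm, ← pow_add]
      exact Dvd.dvd.mul_left (pow_dvd_pow _ (by omega)) _
    have hz : ∑ l' ∈ T, aeval g (homPart l' P) = 0 := by
      by_contra hne
      have h6 := Polynomial.natDegree_le_of_dvd hdvd hne
      rw [Polynomial.natDegree_X_pow] at h6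
      -- If no term has degree 0 in f''', then t = 0 kills every term.
      have hex : ∃ l' ∈ T, l' 2 = 0 := by
        by_contra hno
        push Not at hno
        apply hne
        refine Finset.sum_eq_zero fun l' hl' => Polynomial.funext fun ε => ?_
        rw [eval_aeval_polynomial, hg]
        have h2 := eval_pt_smul (homPart_mem l' P) 1 1 0 ![1, s - ε] ![1, s] 0
        rw [one_smul, one_smul, zero_smul, zero_pow (hno l' hl')] at h2
        simpa using h2
      obtain ⟨l₀, hl₀, hl₀2⟩ := hex
      have h7 := mem_degPart h hP hl hl₀
      have h8 : (∑ l' ∈ T, aeval g (homPart l' P)).natDegree ≤ l 0 - l 2 := by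
        refine Polynomial.natDegree_sum_le_of_forall_le _ _ fun l' hl' => ?_
        obtain ⟨h3, h4, h5⟩ := mem_degPart h hP hl hl'
        by_cases h0 : l' 2 = 0
        · refine (natDegree_aeval_le (homPart_mem l' P) g ?_ ?_ ?_).trans (by omega)
          · intro i
            fin_cases i
            · simp [g]
            · exact Polynomial.natDegree_sub_le_of_le (Polynomial.natDegree_C s).le.step
                Polynomial.natDegree_X_le
          · intro i
            fin_cases i <;> simp [g]
          · intro i
            fin_cases i <;> simp [g]
        · have : aeval g (homPart l' P) = 0 := by
            refine Polynomial.funext fun ε => ?_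
            rw [eval_aeval_polynomial, hg]
            have h2 := eval_pt_smul (homPart_mem l' P) 1 1 0 ![1, s - ε] ![1, s] 0
            rw [one_smul, one_smul, zero_smul, zero_pow h0] at h2
            simpa using h2
          rw [this]
          simp
      omega
    intro ε
    have := congrArg (Polynomial.eval ε) hz
    simpa only [Polynomial.eval_finsetSum, eval_aeval_polynomial, hg, Polynomial.eval_zero]
      using this
  have hlead : ∀ s : ℂ, eval (pt ![1, s] ![0, 1] ![0, 1]) (homPart l P) = 0 := by
    intro s
    have h1 := sum_filter_eq_of_forall_ne_zero T (fun l' => l' 1 + l' 2) (fun _ => 0)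
      (fun l' => (-3) ^ l' 2 * eval (pt ![1, s] ![0, 1] ![0, 1]) (homPart l' P)) (fun _ => 0) ?_
      (l 1 + l 2)
    · rw [Finset.sum_const_zero] at h1
      have h2 := sum_degPart_filter h hP hl
        (fun l' => (-3) ^ l' 2 * eval (pt ![1, s] ![0, 1] ![0, 1]) (homPart l' P))
        (fun h' => by simp [h'])
      rw [← hT] at h2
      -- On the line of `mem_degPart`, the exponent of ε determines `l' 2`, so the coefficient of
      -- ε^(l 1 + l 2) involves `l` alone.
      have h3 : ({l' ∈ T | l' 1 + l' 2 = l 1 + l 2}) = {l' ∈ T | l' 2 = l 2} := by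
        refine Finset.filter_congr fun l' hl' => ?_
        obtain ⟨h3, h4, h5⟩ := mem_degPart h hP hl hl'
        omega
      rw [h3, h2] at h1
      exact (mul_eq_zero.1 h1).resolve_left (pow_ne_zero _ (by norm_num))
    · intro ε _
      -- Replacing s by s + ε makes u = (1, s) independent of ε, so the powers of ε are explicit.
      have h1 := key (s + ε) ε
      rw [hzero, add_sub_cancel_right] at h1
      simp only [mul_zero, Finset.sum_const_zero]
      refine Eq.trans (Finset.sum_congr rfl fun l' _ => ?_) h1.symm
      ring
  -- The factor f₁' takes care of the locus f₁' = 0, where the normal form is not available.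
  have hX : X (0, 0) * homPart l P = 0 := by
    refine MvPolynomial.funext fun x => ?_
    rw [map_mul, eval_X, map_zero, mul_eq_zero]
    by_cases hx : x (0, 0) = 0
    · exact Or.inl hx
    right
    have h1 := h.eval_homPart_eq hP hl (fun i => x (0, i)) (fun i => x (1, i))
      (fun i => x (2, i)) hx
    have h2 := eval_pt_smul (homPart_mem l P) (x (0, 0)) 1 1 ![1, x (0, 1) / x (0, 0)]
      ![0, 1] ![0, 1]
    have h3 : x (0, 0) • ![1, x (0, 1) / x (0, 0)] = fun i => x (0, i) := by
      ext i
      fin_cases i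
      · simp
      · simp
        field_simp
    rw [hlead, h3, one_smul, mul_zero] at h2
    rw [h2, mul_zero, pt_eta] at h1
    exact (mul_eq_zero.1 h1).resolve_left (pow_ne_zero _ hx)
  exact (mul_eq_zero.1 hX).resolve_left (X_ne_zero _)

end Invariant

/-! ### The leading parts of invariant polynomials -/

section LeadingPart

/-- The Wronskian `f₁' f₂⁽ʲ⁺¹⁾ - f₂' f₁⁽ʲ⁺¹⁾`. -/
def wronskian {k : ℕ} [NeZero k] (j : Fin k) : MvPolynomial (Fin k × Fin 2) ℂ :=
  X (0, 0) * X (j, 1) - X (0, 1) * X (j, 0)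

/-- A polynomial in `f'`, seen as a polynomial in all the derivatives. -/
def ofFirst (k : ℕ) [NeZero k] : MvPolynomial (Fin 2) ℂ →ₐ[ℂ] MvPolynomial (Fin k × Fin 2) ℂ :=
  rename fun i => (0, i)

theorem ofFirst_injective (k : ℕ) [NeZero k] : Function.Injective (ofFirst k) :=
  rename_injective _ fun _ _ h => (Prod.mk.inj h).2

theorem eval_ofFirst (k : ℕ) [NeZero k] (q : MvPolynomial (Fin 2) ℂ) (x : Fin k × Fin 2 → ℂ) :
    eval x (ofFirst k q) = eval (fun i => x (0, i)) q := by
  rw [ofFirst, eval_rename]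
  rfl

theorem wronskian_ne_zero {k : ℕ} [NeZero k] {j : Fin k} (hj : j ≠ 0) :
    (wronskian j : MvPolynomial (Fin k × Fin 2) ℂ) ≠ 0 := by
  intro h
  have := congrArg (eval fun p : Fin k × Fin 2 =>
    if p = (0, 0) then (1 : ℂ) else if p = (j, 1) then 1 else 0) h
  simp [wronskian, hj] at this

theorem wronskian_mem {j : Fin 3} :
    (wronskian j : MvPolynomial (Fin 3 × Fin 2) ℂ) ∈
      homSub 3 2 (Pi.single 0 1 + Pi.single j 1) := by
  have h1 := mul_mem_homSub (X_mem_homSub ((0, 0) : Fin 3 × Fin 2)) (X_mem_homSub (j, 1))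
  have h2 := mul_mem_homSub (X_mem_homSub ((0, 1) : Fin 3 × Fin 2)) (X_mem_homSub (j, 0))
  rw [wronskian]
  exact Submodule.sub_mem _ h1 h2

/-- Substitution of `(0, 1)` for all the derivatives of order at least `2`. -/
def atSecond (k : ℕ) [NeZero k] :
    MvPolynomial (Fin k × Fin 2) ℂ →ₐ[ℂ] MvPolynomial (Fin 2) ℂ :=
  aeval fun p => if p.1 = 0 then X p.2 else if p.2 = 0 then 0 else 1

theorem atSecond_ofFirst (k : ℕ) [NeZero k] (q : MvPolynomial (Fin 2) ℂ) :
    atSecond k (ofFirst k q) = q := by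
  rw [atSecond, ofFirst, aeval_rename]
  simp [Function.comp_def]

theorem atSecond_wronskian {k : ℕ} [NeZero k] {j : Fin k} (hj : j ≠ 0) :
    atSecond k (wronskian j) = X 0 := by
  simp [atSecond, wronskian, hj]

theorem eval_atSecond (R : MvPolynomial (Fin 3 × Fin 2) ℂ) (u : Fin 2 → ℂ) :
    eval u (atSecond 3 R) = eval (pt u ![0, 1] ![0, 1]) R := by
  induction R using MvPolynomial.induction_on with
  | C a => simp
  | add p q hp hq => simp [hp, hq]
  | mul_X p i hp =>
    rw [map_mul, map_mul, hp, map_mul]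
    congr 1
    obtain ⟨j, i⟩ := i
    fin_cases j <;> fin_cases i <;> simp [atSecond, pt]

theorem isHomogeneous_atSecond {l : Fin 3 → ℕ} {R : MvPolynomial (Fin 3 × Fin 2) ℂ}
    (hR : R ∈ homSub 3 2 l) : (atSecond 3 R).IsHomogeneous (l 0) := by
  rw [R.as_sum, map_sum]
  refine IsHomogeneous.sum _ _ _ fun d hd => ?_
  have hd' : multidegree d = l := mem_restrictSupport_iff_coeff.1 hR d (mem_support_iff.1 hd)
  rw [atSecond, aeval_monomial, Finsupp.prod_fintype _ _ (by simp)]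
  have h1 : ∀ p : Fin 3 × Fin 2, ((if p.1 = 0 then X p.2 else if p.2 = 0 then 0 else 1 :
      MvPolynomial (Fin 2) ℂ) ^ d p).IsHomogeneous (if p.1 = 0 then d p else 0) := by
    intro p
    split_ifs with h h'
    · simpa using (isHomogeneous_X ℂ p.2).pow (d p)
    · rcases Nat.eq_zero_or_pos (d p) with h0 | h0
      · rw [h0, pow_zero]
        exact isHomogeneous_one _ _
      · rw [zero_pow h0.ne']
        exact isHomogeneous_zero _ _ _
    · rw [one_pow]
      exact isHomogeneous_one _ _
  have h2 := (isHomogeneous_C (Fin 2) (coeff d R)).mul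
    (IsHomogeneous.prod Finset.univ _ _ fun p _ => h1 p)
  rw [algebraMap_eq]
  convert h2 using 1
  rw [zero_add, ← hd', Fintype.sum_prod_type, Fin.sum_univ_three]
  simp [multidegree]

theorem not_X_zero_dvd_X_one_pow (N : ℕ) :
    ¬ (X 0 : MvPolynomial (Fin 2) ℂ) ∣ X 1 ^ N := by
  rintro ⟨c, hc⟩
  have := congrArg (eval ![0, 1]) hc
  simp at this

theorem isHomogeneous_of_X_pow_mul {q : MvPolynomial (Fin 2) ℂ} {N L : ℕ}
    (h : (X 0 ^ N * q).IsHomogeneous L) {d : Fin 2 →₀ ℕ} (hd : coeff d q ≠ 0) :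
    d.degree + N = L := by
  have h1 : coeff (Finsupp.single 0 N + d) (X 0 ^ N * q) ≠ 0 := by
    rw [X_pow_eq_monomial, coeff_monomial_mul, one_mul]
    exact hd
  have h2 := h.coeff_eq_zero (d := Finsupp.single 0 N + d)
  by_contra h3
  refine h1 (h2 ?_)
  rw [map_add, Finsupp.degree_single]
  omega

/-- The leading part of an invariant polynomial is the product of a polynomial in `f'` and
of powers of the two Wronskians. -/
theorem IsInv.exists_homPart_eq {m : ℕ} {P : MvPolynomial (Fin 3 × Fin 2) ℂ} (h : IsInv m P)
    {l : Fin 3 → ℕ} (hP : P ∈ leSub 3 2 l) (hl : l 0 + 2 * l 1 + 3 * l 2 = m) :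
    ∃ q : MvPolynomial (Fin 2) ℂ,
      homPart l P = ofFirst 3 q * wronskian 1 ^ l 1 * wronskian 2 ^ l 2 ∧
      ∀ d, coeff d q ≠ 0 → d.degree + (l 1 + l 2) = l 0 := by
  set r := atSecond 3 (homPart l P) with hr
  have h1 : X (0, 0) ^ (l 1 + l 2) * homPart l P =
      ofFirst 3 r * wronskian 1 ^ l 1 * wronskian 2 ^ l 2 := by
    refine mul_left_cancel₀ (X_ne_zero (R := ℂ) ((0, 0) : Fin 3 × Fin 2)) ?_
    refine MvPolynomial.funext fun x => ?_
    by_cases hx : x (0, 0) = 0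
    · simp [hx]
    have h1 := h.eval_homPart_eq hP hl (fun i => x (0, i)) (fun i => x (1, i))
      (fun i => x (2, i)) hx
    rw [pt_eta, ← eval_atSecond, ← hr] at h1
    simp only [map_mul, map_pow, eval_X, eval_ofFirst, wronskian, map_sub]
    rw [h1]
    ring
  have h2 : X 0 ^ (l 1 + l 2) ∣ r := by
    refine (X_prime (R := ℂ) (i := (0 : Fin 2))).pow_dvd_of_dvd_mul_right _
      (not_X_zero_dvd_X_one_pow (l 1 + l 2)) ?_
    -- At f'' = f''' = (-1, 0) both Wronskians become f₂', which f₁' does not divide. So f₁'^(l 1 +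
    -- l 2) must divide r.
    let φ : MvPolynomial (Fin 3 × Fin 2) ℂ →ₐ[ℂ] MvPolynomial (Fin 2) ℂ :=
      aeval fun p => if p.1 = 0 then X p.2 else if p.2 = 0 then -1 else 0
    have h3 := congrArg φ h1
    have h4 : φ (ofFirst 3 r) = r := by
      simp only [φ]
      rw [ofFirst, aeval_rename]
      simp [Function.comp_def]
    rw [map_mul, map_mul, map_mul, map_pow, map_pow, map_pow, h4] at h3
    refine ⟨φ (homPart l P), ?_⟩
    convert h3.symm using 1
    · simp [φ, wronskian, pow_add, mul_assoc]
    · simp [φ]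
  obtain ⟨q, hq⟩ := h2
  refine ⟨q, ?_, fun d hd => ?_⟩
  · refine mul_left_cancel₀ (pow_ne_zero (l 1 + l 2)
      (X_ne_zero (R := ℂ) ((0, 0) : Fin 3 × Fin 2))) ?_
    rw [h1, hq, map_mul, map_pow, ofFirst, rename_X]
    ring
  · refine isHomogeneous_of_X_pow_mul ?_ hd
    rw [← hq]
    exact isHomogeneous_atSecond (homPart_mem l P)

/-- Substitution of `f''` for `f'''`. -/
def merge : MvPolynomial (Fin 3 × Fin 2) ℂ →ₐ[ℂ] MvPolynomial (Fin 2 × Fin 2) ℂ :=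
  rename fun p => (![0, 1, 1] p.1, p.2)

/-- For a fixed multidegree the exponents b and c are known, so identifying the two Wronskians loses
nothing. It gives the form taken by the polynomials of Γ^{(λ₁, λ₂)} with λ₂ = b + c. -/
theorem merge_lead (q : MvPolynomial (Fin 2) ℂ) (b c : ℕ) :
    merge (ofFirst 3 q * wronskian 1 ^ b * wronskian 2 ^ c) =
      ofFirst 2 q * wronskian 1 ^ (b + c) := by
  rw [map_mul, map_mul, map_pow, map_pow, merge, ofFirst, rename_rename]
  simp only [wronskian, map_sub, map_mul, rename_X, pow_add, ofFirst, mul_assoc]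
  rfl

theorem ofFirst_mul_wronskian_eq_zero {q : MvPolynomial (Fin 2) ℂ} {N : ℕ}
    (h : ofFirst 2 q * wronskian 1 ^ N = 0) : q = 0 := by
  have := (mul_eq_zero.1 h).resolve_right (pow_ne_zero _ (wronskian_ne_zero (by decide)))
  exact ofFirst_injective 2 (by rw [this, map_zero])

/-! ### Lifting leading parts to invariant polynomials -/

/-- The invariant `f_i' (f₁' f₂''' - f₂' f₁''') - 3 f_i'' (f₁' f₂'' - f₂' f₁'')`. -/
def thirdInv (i : Fin 2) : MvPolynomial (Fin 3 × Fin 2) ℂ :=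
  X (0, i) * wronskian 2 - 3 * X (1, i) * wronskian 1

/-- The correction term f_i'' W₁ has degree 0 in f''', hence is lower. -/
theorem isLead_thirdInv (i : Fin 2) :
    IsLead (thirdInv i) (Pi.single 0 2 + Pi.single 2 1) (X (0, i) * wronskian 2) := by
  constructor
  · have := mul_mem_homSub (X_mem_homSub ((0, i) : Fin 3 × Fin 2)) (wronskian_mem (j := 2))
    convert this using 2
    funext j
    fin_cases j <;> simp
  · have h1 : (3 * X (1, i) * wronskian 1 : MvPolynomial (Fin 3 × Fin 2) ℂ) ∈
        homSub 3 2 (Pi.single 1 1 + (Pi.single 0 1 + Pi.single 1 1)) := by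
      have := Submodule.smul_mem _ (3 : ℂ)
        (mul_mem_homSub (X_mem_homSub ((1, i) : Fin 3 × Fin 2)) (wronskian_mem (j := 1)))
      convert this using 1
      rw [smul_eq_C_mul, mul_assoc]
      rfl
    rw [thirdInv, sub_sub_cancel_left]
    refine Submodule.neg_mem _ (leSub_le_ltSub ?_ (homSub_le_leSub _ h1))
    exact ⟨0, fun j hj => absurd hj (by simp), by simp [revLex]⟩

theorem isInv_X (i : Fin 2) : IsInv 1 (X (0, i)) := by
  intro a b c _ x
  simp [act]

theorem isInv_wronskian : IsInv 3 (wronskian 1) := by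
  intro a b c _ x
  simp [act, wronskian]
  ring

/-- W₂ picks up 3a²b W₁, and f_i'' picks up b f_i'. The factor 3 makes the two extra terms 3a³b f_i'
W₁ cancel. -/
theorem isInv_thirdInv (i : Fin 2) : IsInv 5 (thirdInv i) := by
  intro a b c _ x
  fin_cases i <;> simp [act, thirdInv, wronskian] <;> ring

theorem IsInv.mul {m m' : ℕ} {P P' : MvPolynomial (Fin 3 × Fin 2) ℂ} (h : IsInv m P)
    (h' : IsInv m' P') : IsInv (m + m') (P * P') := by
  intro a b c ha x
  rw [map_mul, map_mul, h a b c ha, h' a b c ha]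
  ring

theorem IsInv.pow {m : ℕ} {P : MvPolynomial (Fin 3 × Fin 2) ℂ} (h : IsInv m P) (N : ℕ) :
    IsInv (N * m) (P ^ N) := by
  intro a b c ha x
  rw [map_pow, map_pow, h a b c ha]
  ring

theorem IsInv.sum_smul {m : ℕ} {ι : Type*} (s : Finset ι) (a : ι → ℂ)
    (P : ι → MvPolynomial (Fin 3 × Fin 2) ℂ) (h : ∀ i ∈ s, IsInv m (P i)) :
    IsInv m (∑ i ∈ s, a i • P i) := by
  intro a' b c ha x
  rw [map_sum, map_sum, Finset.mul_sum]
  refine Finset.sum_congr rfl fun i hi => ?_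
  rw [smul_eval, smul_eval, h i hi a' b c ha]
  ring

/-- An invariant polynomial with leading part
`(f₁')^(d 0) (f₂')^(d 1) (f₁' f₂'' - f₂' f₁'')^b (f₁' f₂''' - f₂' f₁''')^c`. -/
def liftMono (b c : ℕ) (d : Fin 2 →₀ ℕ) : MvPolynomial (Fin 3 × Fin 2) ℂ :=
  -- Of the c factors W₂, min (d 0) c are paired with f₁' and the others with f₂'. The subtractions
  -- are exact when c ≤ d 0 + d 1.
  X (0, 0) ^ (d 0 - min (d 0) c) * X (0, 1) ^ (d 1 - (c - min (d 0) c)) * wronskian 1 ^ b *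
    (thirdInv 0 ^ min (d 0) c * thirdInv 1 ^ (c - min (d 0) c))

theorem isInv_liftMono {b c : ℕ} {d : Fin 2 →₀ ℕ} (h : c ≤ d.degree) :
    IsInv (d.degree + 3 * b + 4 * c) (liftMono b c d) := by
  have h1 := ((((isInv_X 0).pow (d 0 - min (d 0) c)).mul
    ((isInv_X 1).pow (d 1 - (c - min (d 0) c)))).mul (isInv_wronskian.pow b)).mul
    (((isInv_thirdInv 0).pow (min (d 0) c)).mul ((isInv_thirdInv 1).pow (c - min (d 0) c)))
  have h2 : d.degree = d 0 + d 1 := by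
    rw [Finsupp.degree_eq_sum, Fin.sum_univ_two]
  rw [liftMono]
  convert h1 using 1
  omega

theorem isLead_liftMono {b c : ℕ} {d : Fin 2 →₀ ℕ} (h : c ≤ d.degree) {l : Fin 3 → ℕ}
    (h0 : l 0 = d.degree + b + c) (h1 : l 1 = b) (h2 : l 2 = c) :
    IsLead (liftMono b c d) l
      (ofFirst 3 (monomial d 1) * wronskian 1 ^ b * wronskian 2 ^ c) := by
  have hd : d.degree = d 0 + d 1 := by
    rw [Finsupp.degree_eq_sum, Fin.sum_univ_two]
  have key := ((((isLead_of_mem (X_mem_homSub ((0, 0) : Fin 3 × Fin 2))).pow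
    (d 0 - min (d 0) c)).mul ((isLead_of_mem (X_mem_homSub ((0, 1) : Fin 3 × Fin 2))).pow
    (d 1 - (c - min (d 0) c)))).mul ((isLead_of_mem (wronskian_mem (j := 1))).pow b)).mul
    (((isLead_thirdInv 0).pow (min (d 0) c)).mul ((isLead_thirdInv 1).pow (c - min (d 0) c)))
  rw [liftMono]
  convert key using 1
  · ext j
    fin_cases j <;> simp <;> omega
  · have e : ofFirst 3 (monomial d (1 : ℂ)) = X (0, 0) ^ d 0 * X (0, 1) ^ d 1 := by
      rw [ofFirst, monomial_eq, Finsupp.prod_fintype _ _ (by simp), Fin.prod_univ_two]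
      simp
    obtain ⟨p, hp⟩ : ∃ p, p = min (d 0) c := ⟨_, rfl⟩
    obtain ⟨p', hp'⟩ := Nat.exists_eq_add_of_le (show p ≤ d 0 by omega)
    obtain ⟨r, hr⟩ := Nat.exists_eq_add_of_le (show p ≤ c by omega)
    obtain ⟨s, hs⟩ := Nat.exists_eq_add_of_le (show r ≤ d 1 by omega)
    rw [e, ← hp, show d 0 - p = p' by omega, show c - p = r by omega,
      show d 1 - r = s by omega, hp', hr, hs]
    ring

/-- An invariant polynomial with leading part
`q(f') (f₁' f₂'' - f₂' f₁'')^b (f₁' f₂''' - f₂' f₁''')^c`, for `q` homogeneous of degree `a`. -/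
def lift (a b c : ℕ) (q : MvPolynomial (Fin 2) ℂ) : MvPolynomial (Fin 3 × Fin 2) ℂ :=
  ∑ d ∈ Finset.finsuppAntidiag Finset.univ a, coeff d q • liftMono b c d

theorem mem_finsuppAntidiag_univ {a : ℕ} {d : Fin 2 →₀ ℕ} :
    d ∈ Finset.finsuppAntidiag Finset.univ a ↔ d.degree = a := by
  rw [Finset.mem_finsuppAntidiag, Finsupp.degree_eq_sum]
  simp

theorem isInv_lift {a b c m : ℕ} (hca : c ≤ a) (hm : a + 3 * b + 4 * c = m)
    (q : MvPolynomial (Fin 2) ℂ) : IsInv m (lift a b c q) := by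
  refine IsInv.sum_smul _ _ _ fun d hd => ?_
  have := mem_finsuppAntidiag_univ.1 hd
  rw [← hm, ← this]
  exact isInv_liftMono (by omega)

theorem isLead_lift {a b c : ℕ} (hca : c ≤ a) {l : Fin 3 → ℕ}
    (h0 : l 0 = a + b + c) (h1 : l 1 = b) (h2 : l 2 = c) {q : MvPolynomial (Fin 2) ℂ}
    (hq : ∀ d, coeff d q ≠ 0 → d.degree = a) :
    IsLead (lift a b c q) l (ofFirst 3 q * wronskian 1 ^ b * wronskian 2 ^ c) := by
  have e : q = ∑ d ∈ Finset.finsuppAntidiag Finset.univ a, coeff d q • monomial d 1 := by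
    conv_lhs => rw [q.as_sum]
    rw [Finset.sum_subset (s₂ := Finset.finsuppAntidiag Finset.univ a)]
    · simp [smul_monomial]
    · intro d hd
      exact mem_finsuppAntidiag_univ.2 (hq d (mem_support_iff.1 hd))
    · intro d _ hd
      rw [notMem_support_iff.1 hd, map_zero]
  have key : IsLead (lift a b c q) l (∑ d ∈ Finset.finsuppAntidiag Finset.univ a,
      coeff d q • (ofFirst 3 (monomial d 1) * wronskian 1 ^ b * wronskian 2 ^ c)) := by
    refine IsLead.sum _ fun d hd => IsLead.smul (isLead_liftMono ?_ ?_ h1 h2) _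
    · rw [mem_finsuppAntidiag_univ.1 hd]
      exact hca
    · rw [mem_finsuppAntidiag_univ.1 hd]
      exact h0
  convert key using 1
  conv_lhs => rw [e]
  rw [map_sum, Finset.sum_mul, Finset.sum_mul]
  simp only [map_smul, smul_mul_assoc]

end LeadingPart

/-! ### Schur powers as spaces of polynomials -/

section SchurPoly

theorem exists_perm_of_card_fiber_eq {α β : Type*} [Fintype α] [DecidableEq β] (F G : α → β)
    (h : ∀ y, Fintype.card {x // F x = y} = Fintype.card {x // G x = y}) :
    ∃ σ : Equiv.Perm α, ∀ x, G (σ x) = F x := by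
  let e : ∀ y, {x // F x = y} ≃ {x // G x = y} := fun y => Fintype.equivOfCardEq (h y)
  refine ⟨(Equiv.sigmaFiberEquiv F).symm.trans
    ((Equiv.sigmaCongrRight e).trans (Equiv.sigmaFiberEquiv G)), fun x => ?_⟩
  exact (e (F x) ⟨x, rfl⟩).2

variable {r : ℕ} {lam : Fin r → ℕ}

theorem mem_rowPerms {p : Equiv.Perm (Box lam)} : p ∈ rowPerms lam ↔ ∀ b, (p b).1 = b.1 := by
  simp [rowPerms]

theorem mul_mem_rowPerms {p q : Equiv.Perm (Box lam)} (hp : p ∈ rowPerms lam)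
    (hq : q ∈ rowPerms lam) : p * q ∈ rowPerms lam := by
  rw [mem_rowPerms] at *
  intro b
  rw [Equiv.Perm.mul_apply, hp, hq]

theorem inv_mem_rowPerms {p : Equiv.Perm (Box lam)} (hp : p ∈ rowPerms lam) :
    p⁻¹ ∈ rowPerms lam := by
  rw [mem_rowPerms] at *
  intro b
  exact (hp (p⁻¹ b)).symm.trans (congrArg Sigma.fst (p.apply_symm_apply b))

theorem card_rowPerms_ne_zero : ((rowPerms lam).card : ℂ) ≠ 0 := by
  rw [Nat.cast_ne_zero]
  exact Finset.card_ne_zero_of_mem (mem_rowPerms.2 fun b =>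
    (rfl : ((1 : Equiv.Perm (Box lam)) b).1 = b.1))

theorem sum_rowPerms_mul_left {M : Type*} [AddCommMonoid M] {σ : Equiv.Perm (Box lam)}
    (hσ : σ ∈ rowPerms lam) (f : Equiv.Perm (Box lam) → M) :
    ∑ p ∈ rowPerms lam, f (σ * p) = ∑ p ∈ rowPerms lam, f p :=
  Finset.sum_nbij' (fun p => σ * p) (fun p => σ⁻¹ * p) (fun _ hp => mul_mem_rowPerms hσ hp)
    (fun _ hp => mul_mem_rowPerms (inv_mem_rowPerms hσ) hp) (by simp) (by simp) (by simp)

theorem sum_rowPerms_inv {M : Type*} [AddCommMonoid M] (f : Equiv.Perm (Box lam) → M) :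
    ∑ p ∈ rowPerms lam, f p⁻¹ = ∑ p ∈ rowPerms lam, f p :=
  Finset.sum_nbij' (fun p => p⁻¹) (fun p => p⁻¹) (fun _ hp => inv_mem_rowPerms hp)
    (fun _ hp => inv_mem_rowPerms hp) (by simp) (by simp) (by simp)

/-- The exponent of the monomial `∏ X (row of b, a b)`. -/
def boxExp (a : Box lam → Fin 2) : Fin r × Fin 2 →₀ ℕ :=
  ∑ b, Finsupp.single (b.1, a b) 1

/-- The exponent counts the boxes of each row that carry each value, and these counts determine a
filling up to permutations of the rows. -/
theorem exists_rowPerm_of_boxExp_eq {a a' : Box lam → Fin 2} (h : boxExp a = boxExp a') :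
    ∃ σ ∈ rowPerms lam, a' ∘ σ = a := by
  have key : ∀ (a : Box lam → Fin 2) (y : Fin r × Fin 2),
      Fintype.card {b : Box lam // (b.1, a b) = y} = boxExp a y := by
    intro a y
    rw [boxExp, Finsupp.finsetSum_apply, Fintype.card_subtype, Finset.card_filter]
    simp only [Finsupp.single_apply]
  obtain ⟨σ, hσ⟩ := exists_perm_of_card_fiber_eq (fun b : Box lam => (b.1, a b))
    (fun b => (b.1, a' b)) fun y => by rw [key, key, h]
  refine ⟨σ, mem_rowPerms.2 fun b => (Prod.mk.inj (hσ b)).1, ?_⟩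
  funext b
  exact (Prod.mk.inj (hσ b)).2

variable {V : Type*} [AddCommGroup V] [Module ℂ V]

/-- The linear form `v`, in the variables with first index `j`. -/
def linForm (β : Module.Basis (Fin 2) ℂ V) (j : Fin r) : V →ₗ[ℂ] MvPolynomial (Fin r × Fin 2) ℂ :=
  β.constr ℂ fun i => X (j, i)

theorem linForm_basis (β : Module.Basis (Fin 2) ℂ V) (j : Fin r) (i : Fin 2) :
    linForm β j (β i) = X (j, i) := by
  rw [linForm, Module.Basis.constr_basis]

theorem linForm_eq (β : Module.Basis (Fin 2) ℂ V) (j : Fin r) (v : V) :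
    linForm β j v = C (β.repr v 0) * X (j, 0) + C (β.repr v 1) * X (j, 1) := by
  rw [linForm, Module.Basis.constr_apply_fintype, Fin.sum_univ_two, smul_eq_C_mul, smul_eq_C_mul]
  rfl

/-- The polynomial obtained by evaluating a tensor of linear forms at `f⁽ⁱ⁺¹⁾` on the boxes of the
row `i`. -/
def tensorPoly (lam : Fin r → ℕ) (β : Module.Basis (Fin 2) ℂ V) :
    (⨂[ℂ] _ : Box lam, V) →ₗ[ℂ] MvPolynomial (Fin r × Fin 2) ℂ :=
  PiTensorProduct.lift ((MultilinearMap.mkPiAlgebra ℂ (Box lam)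
    (MvPolynomial (Fin r × Fin 2) ℂ)).compLinearMap fun b => linForm β b.1)

theorem tensorPoly_tprod (β : Module.Basis (Fin 2) ℂ V) (t : Box lam → V) :
    tensorPoly lam β (PiTensorProduct.tprod ℂ t) = ∏ b, linForm β b.1 (t b) := by
  simp [tensorPoly]

theorem tensorPoly_tprod_basis (β : Module.Basis (Fin 2) ℂ V) (a : Box lam → Fin 2) :
    tensorPoly lam β (PiTensorProduct.tprod ℂ fun b => β (a b)) = monomial (boxExp a) 1 := by
  rw [tensorPoly_tprod]
  simp only [linForm_basis, X]
  rw [boxExp, monomial_sum_one]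

/-- The effect on the polynomials of a change of basis. -/
theorem tensorPoly_change (β β' : Module.Basis (Fin 2) ℂ V) (A : Fin 2 → Fin 2 → ℂ)
    (h : ∀ i, β i = ∑ k, A i k • β' k) (T : ⨂[ℂ] _ : Box lam, V) :
    tensorPoly lam β' T =
      bind₁ (fun p => ∑ k, A p.2 k • X (p.1, k)) (tensorPoly lam β T) := by
  have key : tensorPoly lam β' = (bind₁ (fun p : Fin r × Fin 2 =>
      ∑ k, A p.2 k • (X (p.1, k) : MvPolynomial (Fin r × Fin 2) ℂ))).toLinearMap ∘ₗ
        tensorPoly lam β := by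
    refine PiTensorProduct.ext (Module.Basis.ext_multilinear (fun _ => β) fun a => ?_)
    simp only [LinearMap.compMultilinearMap_apply, LinearMap.comp_apply, AlgHom.toLinearMap_apply,
      tensorPoly_tprod, map_prod, linForm_basis, bind₁_X_right]
    refine Finset.prod_congr rfl fun b _ => ?_
    rw [h, map_sum]
    simp only [map_smul, linForm_basis]
  rw [key]
  rfl

/-- The action of a permutation of the boxes. -/
abbrev boxPerm (V : Type*) [AddCommGroup V] [Module ℂ V] (p : Equiv.Perm (Box lam)) :
    (⨂[ℂ] _ : Box lam, V) →ₗ[ℂ] (⨂[ℂ] _ : Box lam, V) :=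
  (PiTensorProduct.reindex ℂ (fun _ : Box lam => V) p).toLinearMap

theorem boxPerm_tprod (p : Equiv.Perm (Box lam)) (t : Box lam → V) :
    boxPerm V p (PiTensorProduct.tprod ℂ t) = PiTensorProduct.tprod ℂ fun b => t (p⁻¹ b) :=
  PiTensorProduct.reindex_tprod _ _

theorem boxPerm_boxPerm (p q : Equiv.Perm (Box lam)) (T : ⨂[ℂ] _ : Box lam, V) :
    boxPerm V p (boxPerm V q T) = boxPerm V (p * q) T := by
  have : boxPerm V p ∘ₗ boxPerm V q = boxPerm V (p * q) := by
    refine PiTensorProduct.ext (MultilinearMap.ext fun t => ?_)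
    simp only [LinearMap.compMultilinearMap_apply, LinearMap.comp_apply, boxPerm_tprod]
    simp
  exact LinearMap.congr_fun this T

/-- The row sum is the last factor of the symmetrizer, so every element of its image is fixed by the
row permutations. -/
theorem sum_boxPerm_of_mem_schur {T : ⨂[ℂ] _ : Box lam, V} (hT : T ∈ schur lam V) :
    ∑ p ∈ rowPerms lam, boxPerm V p T = ((rowPerms lam).card : ℂ) • T := by
  obtain ⟨S, rfl⟩ := hT
  obtain ⟨U, hU⟩ : ∃ U, youngSymmetrizer lam V S = ∑ p ∈ rowPerms lam, boxPerm V p U :=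
    ⟨_, by rw [youngSymmetrizer, LinearMap.comp_apply, LinearMap.sum_apply]⟩
  rw [hU]
  have : ∀ p ∈ rowPerms lam, boxPerm V p (∑ q ∈ rowPerms lam, boxPerm V q U) =
      ∑ q ∈ rowPerms lam, boxPerm V q U := by
    intro p hp
    rw [map_sum, ← sum_rowPerms_mul_left hp fun q => boxPerm V q U]
    exact Finset.sum_congr rfl fun q _ => boxPerm_boxPerm p q U
  rw [Finset.sum_congr rfl this, Finset.sum_const, Nat.cast_smul_eq_nsmul]

open Classical in
/-- A choice of the boxes where a monomial takes its factors. -/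
def boxSection (d : Fin r × Fin 2 →₀ ℕ) : Box lam → Fin 2 :=
  -- The default 0 plays no role: `tensorCoeff` sums only over exponents of actual fillings.
  if h : ∃ a : Box lam → Fin 2, boxExp a = d then h.choose else 0

theorem boxExp_boxSection (a : Box lam → Fin 2) :
    boxExp (boxSection (boxExp a) : Box lam → Fin 2) = boxExp a := by
  have h : ∃ a' : Box lam → Fin 2, boxExp a' = boxExp a := ⟨a, rfl⟩
  rw [boxSection, dif_pos h]
  exact h.choose_spec

/-- The permutations of the rows that transform `a` into `a'`. -/
def rowsTo (a a' : Box lam → Fin 2) : Finset (Equiv.Perm (Box lam)) :=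
  (rowPerms lam).filter fun p : Equiv.Perm (Box lam) => a ∘ ⇑p = a'

variable (lam) in
/-- The coefficient of `⊗ β (a b)` in a row-symmetric tensor, as a function of its polynomial. -/
def tensorCoeff (a : Box lam → Fin 2) : MvPolynomial (Fin r × Fin 2) ℂ →ₗ[ℂ] ℂ :=
  ((rowPerms lam).card : ℂ)⁻¹ • ∑ d ∈ Finset.univ.image (boxExp (lam := lam)),
    ((rowsTo (boxSection d) a).card : ℂ) • lcoeff ℂ d

theorem tensorCoeff_eq_sum (a : Box lam → Fin 2) (R : MvPolynomial (Fin r × Fin 2) ℂ) :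
    tensorCoeff lam a R = ∑ d ∈ Finset.univ.image (boxExp (lam := lam)),
      (((rowPerms lam).card : ℂ)⁻¹ * ((rowsTo (boxSection d) a).card : ℂ)) *
        coeff d R := by
  simp only [tensorCoeff, LinearMap.smul_apply, LinearMap.sum_apply, smul_eq_mul, lcoeff_apply,
    Finset.mul_sum, mul_assoc]

/-- A tensor in a Schur power is determined by its polynomial. -/
theorem eq_sum_tensorCoeff (β : Module.Basis (Fin 2) ℂ V) {T : ⨂[ℂ] _ : Box lam, V}
    (hT : T ∈ schur lam V) :
    T = ∑ a, tensorCoeff lam a (tensorPoly lam β T) • PiTensorProduct.tprod ℂ fun b => β (a b) := by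
  -- An identity of operators on all tensors: the row sum of a tensor can be rebuilt from its
  -- polynomial. On the Schur power the row sum is multiplication by the number of row permutations.
  have key : ∑ p ∈ rowPerms lam, boxPerm V p = ((rowPerms lam).card : ℂ) •
      ∑ a, ((tensorCoeff lam a) ∘ₗ tensorPoly lam β).smulRight
        (PiTensorProduct.tprod ℂ fun b => β (a b)) := by
    refine PiTensorProduct.ext (Module.Basis.ext_multilinear (fun _ => β) fun a => ?_)
    simp only [LinearMap.compMultilinearMap_apply, LinearMap.sum_apply, LinearMap.smul_apply,
      LinearMap.smulRight_apply, LinearMap.comp_apply, boxPerm_tprod, tensorPoly_tprod_basis]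
    have h1 : ∀ a', tensorCoeff lam a' (monomial (boxExp a) 1) =
        ((rowPerms lam).card : ℂ)⁻¹ *
          ((rowsTo (boxSection (boxExp a)) a').card : ℂ) := by
      intro a'
      rw [tensorCoeff_eq_sum, Finset.sum_eq_single (boxExp a)]
      · simp
      · intro d _ hd
        rw [coeff_monomial, if_neg (Ne.symm hd), mul_zero]
      · intro h
        exact absurd (Finset.mem_image_of_mem _ (Finset.mem_univ a)) h
    simp only [h1, mul_smul]
    rw [← Finset.smul_sum, smul_inv_smul₀ card_rowPerms_ne_zero]
    have h2 : ∑ a' : Box lam → Fin 2,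
        ((rowsTo (boxSection (boxExp a)) a').card : ℂ) •
          PiTensorProduct.tprod ℂ (fun b => β (a' b)) =
        ∑ p ∈ rowPerms lam, PiTensorProduct.tprod ℂ
          (fun b => β ((boxSection (boxExp a) : Box lam → Fin 2) (p b))) := by
      rw [← Finset.sum_fiberwise (rowPerms lam)
        (fun p => (boxSection (boxExp a) : Box lam → Fin 2) ∘ p)]
      refine Finset.sum_congr rfl fun a' _ => ?_
      rw [Nat.cast_smul_eq_nsmul, ← Finset.sum_const]
      refine Finset.sum_congr rfl fun p hp => ?_
      rw [← (Finset.mem_filter.1 hp).2]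
      rfl
    rw [h2, sum_rowPerms_inv (fun p => PiTensorProduct.tprod ℂ fun b => β (a (p b)))]
    -- The chosen filling and `a` differ by a row permutation, which the row sum absorbs.
    obtain ⟨σ, hσ, hσ'⟩ := exists_rowPerm_of_boxExp_eq (boxExp_boxSection a)
    rw [← sum_rowPerms_mul_left hσ]
    refine Finset.sum_congr rfl fun p _ => ?_
    rw [← hσ']
    rfl
  have h1 := LinearMap.congr_fun key T
  rw [LinearMap.sum_apply, sum_boxPerm_of_mem_schur hT, LinearMap.smul_apply] at h1
  have h2 := smul_right_injective _ (card_rowPerms_ne_zero (lam := lam)) h1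
  rw [LinearMap.sum_apply] at h2
  simpa only [LinearMap.smulRight_apply, LinearMap.comp_apply] using h2

theorem tensorPoly_injOn (β : Module.Basis (Fin 2) ℂ V) {T T' : ⨂[ℂ] _ : Box lam, V}
    (hT : T ∈ schur lam V) (hT' : T' ∈ schur lam V)
    (h : tensorPoly lam β T = tensorPoly lam β T') : T = T' := by
  rw [eq_sum_tensorCoeff β hT, eq_sum_tensorCoeff β hT', h]

theorem prod_linForm_perm (β : Module.Basis (Fin 2) ℂ V) (p : Equiv.Perm (Box lam))
    (t : Box lam → V) :
    tensorPoly lam β (boxPerm V p (PiTensorProduct.tprod ℂ t)) =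
      ∏ b, linForm β (p b).1 (t b) := by
  rw [boxPerm_tprod, tensorPoly_tprod, ← Equiv.prod_comp p]
  simp

theorem tensorPoly_boxPerm_of_mem (β : Module.Basis (Fin 2) ℂ V) {p : Equiv.Perm (Box lam)}
    (hp : p ∈ rowPerms lam) (T : ⨂[ℂ] _ : Box lam, V) :
    tensorPoly lam β (boxPerm V p T) = tensorPoly lam β T := by
  have : tensorPoly lam β ∘ₗ boxPerm V p = tensorPoly lam β := by
    refine PiTensorProduct.ext (MultilinearMap.ext fun t => ?_)
    simp only [LinearMap.compMultilinearMap_apply, LinearMap.comp_apply]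
    rw [prod_linForm_perm, tensorPoly_tprod]
    exact Finset.prod_congr rfl fun b _ => by rw [mem_rowPerms.1 hp]
  exact LinearMap.congr_fun this T

/-- The matrix whose determinant expands into the antisymmetrization over the columns. -/
def colMatrix (β : Module.Basis (Fin 2) ℂ V) (t : Box lam → V) :
    Matrix (Box lam) (Box lam) (MvPolynomial (Fin r × Fin 2) ℂ) :=
  Matrix.of fun b' b => if b'.2.val = b.2.val then linForm β b'.1 (t b) else 0

/-- The polynomial does not see row permutations, so the row sum only contributes their number. The
signed column sum is the expansion of a determinant whose entries between different columns vanish.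
-/
theorem tensorPoly_youngSymmetrizer (β : Module.Basis (Fin 2) ℂ V) (t : Box lam → V) :
    tensorPoly lam β (youngSymmetrizer lam V (PiTensorProduct.tprod ℂ t)) =
      ((rowPerms lam).card : ℂ) • (colMatrix β t).det := by
  rw [youngSymmetrizer, LinearMap.comp_apply, LinearMap.sum_apply, map_sum,
    Finset.sum_congr rfl fun p hp => tensorPoly_boxPerm_of_mem β hp _, Finset.sum_const,
    Nat.cast_smul_eq_nsmul]
  congr 1
  rw [LinearMap.sum_apply, map_sum, Matrix.det_apply, colPerms, Finset.sum_filter]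
  refine Finset.sum_congr rfl fun q _ => ?_
  simp only [colMatrix, Matrix.of_apply, Finset.prod_ite_zero, Finset.mem_univ, true_imp_iff]
  split_ifs with h
  · rw [LinearMap.smul_apply, map_smul, prod_linForm_perm, Units.smul_def, Int.cast_smul_eq_zsmul]
  · rw [smul_zero]

end SchurPoly

/-! ### Diagrams with two rows -/

section TwoRows

variable {V : Type*} [AddCommGroup V] [Module ℂ V]

/-- The boxes of a diagram with two rows: the columns of length two and the others. -/
def twoRowBox (N a : ℕ) : (Fin 2 × Fin N) ⊕ Fin a → Box ![N + a, N]
  | Sum.inl (0, j) => ⟨0, Fin.castAdd a j⟩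
  | Sum.inl (1, j) => ⟨1, j⟩
  | Sum.inr j => ⟨0, Fin.natAdd N j⟩

theorem twoRowBox_bijective (N a : ℕ) : Function.Bijective (twoRowBox N a) := by
  constructor
  · intro x y h
    have h1 := congrArg Sigma.fst h
    have h2 := congrArg (fun b => b.2.val) h
    rcases x with ⟨i, j⟩ | j <;> rcases y with ⟨i', j'⟩ | j'
    · fin_cases i <;> fin_cases i' <;> simp [twoRowBox, Fin.ext_iff] at h1 h2 ⊢ <;> exact h2
    · have := j.2
      fin_cases i <;> simp [twoRowBox] at h1 h2
      omega
    · have := j'.2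
      fin_cases i' <;> simp [twoRowBox] at h1 h2
      omega
    · simp [twoRowBox, Fin.ext_iff] at h2 ⊢
      exact h2
  · rintro ⟨i, j⟩
    fin_cases i
    · induction j using Fin.addCases (m := N) (n := a) with
      | left j => exact ⟨Sum.inl (0, j), rfl⟩
      | right j => exact ⟨Sum.inr j, rfl⟩
    · exact ⟨Sum.inl (1, j), rfl⟩

/-- Sorted by columns of the diagram, the matrix is block diagonal. A column of length two gives a
2×2 block, the product of the matrix of coordinates of two covectors with the matrix of f', f'',
whose determinant is the Wronskian. -/
theorem det_colMatrix (β : Module.Basis (Fin 2) ℂ V) (N a : ℕ) (t : Box ![N + a, N] → V) :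
    (colMatrix β t).det =
      (∏ j : Fin N, (C (β.repr (t (twoRowBox N a (Sum.inl (0, j)))) 0 *
          β.repr (t (twoRowBox N a (Sum.inl (1, j)))) 1 -
        β.repr (t (twoRowBox N a (Sum.inl (0, j)))) 1 *
          β.repr (t (twoRowBox N a (Sum.inl (1, j)))) 0) * wronskian 1)) *
      ∏ j : Fin a, linForm β 0 (t (twoRowBox N a (Sum.inr j))) := by
  rw [← Matrix.det_submatrix_equiv_self (Equiv.ofBijective _ (twoRowBox_bijective N a))]
  have : (colMatrix β t).submatrix (Equiv.ofBijective _ (twoRowBox_bijective N a))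
      (Equiv.ofBijective _ (twoRowBox_bijective N a)) =
      Matrix.fromBlocks (Matrix.blockDiagonal fun j => Matrix.of fun i' i =>
        linForm β i' (t (twoRowBox N a (Sum.inl (i, j))))) 0 0
        (Matrix.diagonal fun j => linForm β 0 (t (twoRowBox N a (Sum.inr j)))) := by
    ext1 x y
    rcases x with ⟨i, j⟩ | j <;> rcases y with ⟨i', j'⟩ | j'
    · by_cases hj : j = j'
      · subst hj
        fin_cases i <;> fin_cases i' <;> simp [colMatrix, twoRowBox]
      · have hj' : j.val ≠ j'.val := fun h => hj (Fin.ext h)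
        fin_cases i <;> fin_cases i' <;>
          simp [colMatrix, twoRowBox, Matrix.blockDiagonal_apply, hj, hj']
    · have := j.2
      fin_cases i <;> simp [colMatrix, twoRowBox] <;> omega
    · have := j'.2
      fin_cases i' <;> simp [colMatrix, twoRowBox] <;> omega
    · by_cases hj : j = j'
      · subst hj
        simp [colMatrix, twoRowBox]
      · have hj' : j.val ≠ j'.val := fun h => hj (Fin.ext h)
        simp [colMatrix, twoRowBox, hj, hj']
  rw [this, Matrix.det_fromBlocks_zero₂₁, Matrix.det_blockDiagonal, Matrix.det_diagonal]
  congr 1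
  refine Finset.prod_congr rfl fun j _ => ?_
  rw [Matrix.det_fin_two]
  simp only [Matrix.of_apply, linForm_eq, wronskian, map_sub, map_mul]
  ring

/-- With `exists_mem_schur`, this computes the image of the Schur power: exactly the q(f') W₁^N with
q homogeneous of degree a. -/
theorem exists_tensorPoly_eq (β : Module.Basis (Fin 2) ℂ V) {N a : ℕ}
    {T : ⨂[ℂ] _ : Box ![N + a, N], V} (hT : T ∈ schur ![N + a, N] V) :
    ∃ q : MvPolynomial (Fin 2) ℂ, q.IsHomogeneous a ∧
      tensorPoly ![N + a, N] β T = ofFirst 2 q * wronskian 1 ^ N := by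
  let L : MvPolynomial (Fin 2) ℂ →ₗ[ℂ] MvPolynomial (Fin 2 × Fin 2) ℂ :=
    LinearMap.mulRight ℂ (wronskian 1 ^ N) ∘ₗ (ofFirst 2).toLinearMap
  let S : Submodule ℂ (MvPolynomial (Fin 2 × Fin 2) ℂ) :=
    (homogeneousSubmodule (Fin 2) ℂ a).map L
  suffices h : tensorPoly ![N + a, N] β T ∈ S by
    obtain ⟨q, hq, hq'⟩ := h
    exact ⟨q, hq, hq'.symm⟩
  obtain ⟨U, rfl⟩ := hT
  induction U using PiTensorProduct.induction_on with
  | smul_tprod s t =>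
    rw [map_smul, map_smul, tensorPoly_youngSymmetrizer, det_colMatrix]
    refine Submodule.smul_mem _ _ (Submodule.smul_mem _ _ ?_)
    rw [Finset.prod_mul_distrib, Finset.prod_const, Finset.card_univ, Fintype.card_fin,
      ← map_prod]
    refine ⟨C (∏ j : Fin N, (β.repr (t (twoRowBox N a (Sum.inl (0, j)))) 0 *
          β.repr (t (twoRowBox N a (Sum.inl (1, j)))) 1 -
        β.repr (t (twoRowBox N a (Sum.inl (0, j)))) 1 *
          β.repr (t (twoRowBox N a (Sum.inl (1, j)))) 0)) *
        ∏ j : Fin a, (C (β.repr (t (twoRowBox N a (Sum.inr j))) 0) * X 0 +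
          C (β.repr (t (twoRowBox N a (Sum.inr j))) 1) * X 1), ?_, ?_⟩
    · have h1 := IsHomogeneous.prod (Finset.univ : Finset (Fin a))
        (fun j => (C (β.repr (t (twoRowBox N a (Sum.inr j))) 0) * X 0 +
          C (β.repr (t (twoRowBox N a (Sum.inr j))) 1) * X 1 : MvPolynomial (Fin 2) ℂ))
        (fun _ => 1) fun j _ => (isHomogeneous_C_mul_X _ _).add (isHomogeneous_C_mul_X _ _)
      have h2 := (isHomogeneous_C (Fin 2) (∏ j : Fin N,
        (β.repr (t (twoRowBox N a (Sum.inl (0, j)))) 0 *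
          β.repr (t (twoRowBox N a (Sum.inl (1, j)))) 1 -
        β.repr (t (twoRowBox N a (Sum.inl (0, j)))) 1 *
          β.repr (t (twoRowBox N a (Sum.inl (1, j)))) 0))).mul h1
      simpa using h2
    · simp only [L, LinearMap.comp_apply, AlgHom.toLinearMap_apply, LinearMap.mulRight_apply,
        map_mul, map_prod, map_add, linForm_eq, ofFirst, rename_C, rename_X]
      ring
  | add U U' hU hU' =>
    rw [map_add, map_add]
    exact Submodule.add_mem _ hU hU'

theorem exists_mem_schur (β : Module.Basis (Fin 2) ℂ V) {N a : ℕ} {q : MvPolynomial (Fin 2) ℂ}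
    (hq : ∀ d, coeff d q ≠ 0 → d.degree = a) :
    ∃ T ∈ schur ![N + a, N] V, tensorPoly ![N + a, N] β T = ofFirst 2 q * wronskian 1 ^ N := by
  let L : MvPolynomial (Fin 2) ℂ →ₗ[ℂ] MvPolynomial (Fin 2 × Fin 2) ℂ :=
    LinearMap.mulRight ℂ (wronskian 1 ^ N) ∘ₗ (ofFirst 2).toLinearMap
  suffices h : q ∈ ((schur ![N + a, N] V).map (tensorPoly ![N + a, N] β)).comap L from h
  rw [q.as_sum]
  refine Submodule.sum_mem _ fun d hd => ?_
  have hda := hq d (mem_support_iff.1 hd)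
  rw [← mul_one (coeff d q), ← smul_eq_mul, ← smul_monomial]
  refine Submodule.smul_mem _ _ ?_
  rw [Finsupp.degree_eq_sum, Fin.sum_univ_two] at hda
  subst hda
  let e := Equiv.ofBijective _ (twoRowBox_bijective N (d 0 + d 1))
  -- β 0 above β 1 in each column of length two makes every minor equal to 1. The other boxes carry
  -- d 0 copies of β 0 and d 1 of β 1, which produce the monomial.
  let t : Box ![N + (d 0 + d 1), N] → V := fun b =>
    Sum.elim (fun ij => β ij.1) (Fin.append (fun _ => β 0) (fun _ => β 1)) (e.symm b)
  have ht : ∀ z, t (twoRowBox N (d 0 + d 1) z) =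
      Sum.elim (fun ij => β ij.1) (Fin.append (fun _ => β 0) (fun _ => β 1)) z := by
    intro z
    simp only [t]
    congr 1
    exact e.symm_apply_apply z
  refine ⟨((rowPerms ![N + (d 0 + d 1), N]).card : ℂ)⁻¹ •
    youngSymmetrizer ![N + (d 0 + d 1), N] V (PiTensorProduct.tprod ℂ t),
    Submodule.smul_mem _ _ ⟨_, rfl⟩, ?_⟩
  rw [map_smul, tensorPoly_youngSymmetrizer, inv_smul_smul₀ card_rowPerms_ne_zero, det_colMatrix]
  simp only [ht, Sum.elim_inl, Sum.elim_inr, Fin.prod_univ_add, Fin.append_left, Fin.append_right,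
    linForm_basis, Module.Basis.repr_self]
  simp only [L, LinearMap.comp_apply, AlgHom.toLinearMap_apply, LinearMap.mulRight_apply, ofFirst,
    monomial_eq, Finsupp.prod_fintype, Fin.prod_univ_two, pow_zero, implies_true]
  simp [mul_comm]

end TwoRows

/-! ### Derivatives of order at most three -/

section Derivatives

variable {E F : Type*} [NormedAddCommGroup E] [NormedSpace ℂ E] [NormedAddCommGroup F]
  [NormedSpace ℂ F]

/-- The cubic curve with given derivatives at `0`. -/
def cubic (p v₁ v₂ v₃ : E) (s : ℂ) : E := p + s • v₁ + (s ^ 2 / 2) • v₂ + (s ^ 3 / 6) • v₃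

/-- With the factorials built in, differentiation shifts the coefficients, so iterated derivatives
follow by rewriting. -/
theorem deriv_cubic (p v₁ v₂ v₃ : E) :
    deriv (cubic p v₁ v₂ v₃) = cubic v₁ v₂ v₃ 0 := by
  funext s
  have h1 : HasDerivAt (fun s : ℂ => s • v₁) ((1 : ℂ) • v₁) s := (hasDerivAt_id s).smul_const v₁
  have h2 : HasDerivAt (fun s : ℂ => (s ^ 2 / 2) • v₂) ((((2 : ℕ) : ℂ) * s ^ 1 / 2) • v₂) s :=
    ((hasDerivAt_pow 2 s).div_const 2).smul_const v₂
  have h3 : HasDerivAt (fun s : ℂ => (s ^ 3 / 6) • v₃) ((((3 : ℕ) : ℂ) * s ^ 2 / 6) • v₃) s :=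
    ((hasDerivAt_pow 3 s).div_const 6).smul_const v₃
  refine (((h1.const_add p).add h2).add h3).deriv.trans ?_
  simp only [cubic, smul_zero, add_zero, one_smul, pow_one]
  congr 2
  · congr 1
    push_cast
    ring
  · push_cast
    ring

theorem iteratedDeriv_cubic (p v₁ v₂ v₃ : E) :
    iteratedDeriv 1 (cubic p v₁ v₂ v₃) 0 = v₁ ∧ iteratedDeriv 2 (cubic p v₁ v₂ v₃) 0 = v₂ ∧
      iteratedDeriv 3 (cubic p v₁ v₂ v₃) 0 = v₃ := by
  simp only [iteratedDeriv_eq_iterate, Function.iterate_succ, Function.iterate_zero,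
    Function.comp_apply, id, deriv_cubic]
  simp [cubic]

theorem analyticAt_cubic (p v₁ v₂ v₃ : E) (s : ℂ) : AnalyticAt ℂ (cubic p v₁ v₂ v₃) s := by
  unfold cubic
  fun_prop

variable [CompleteSpace E] [CompleteSpace F]

theorem eventually_analyticAt_comp {g : ℂ → F} {ψ : F → E} (hg : AnalyticAt ℂ g 0)
    (hψ : AnalyticAt ℂ ψ (g 0)) :
    ∀ᶠ s in 𝓝 (0 : ℂ), AnalyticAt ℂ g s ∧ AnalyticAt ℂ ψ (g s) :=
  hg.eventually_analyticAt.and (hg.continuousAt.eventually hψ.eventually_analyticAt)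

/-- The first three derivatives of `ψ ∘ g`. -/
theorem iteratedDeriv_comp_le_three {g : ℂ → F} {ψ : F → E} (hg : AnalyticAt ℂ g 0)
    (hψ : AnalyticAt ℂ ψ (g 0)) :
    iteratedDeriv 1 (ψ ∘ g) 0 = fderiv ℂ ψ (g 0) (iteratedDeriv 1 g 0) ∧
    iteratedDeriv 2 (ψ ∘ g) 0 = fderiv ℂ ψ (g 0) (iteratedDeriv 2 g 0) +
      fderiv ℂ (fderiv ℂ ψ) (g 0) (iteratedDeriv 1 g 0) (iteratedDeriv 1 g 0) ∧
    iteratedDeriv 3 (ψ ∘ g) 0 = fderiv ℂ ψ (g 0) (iteratedDeriv 3 g 0) +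
      (fderiv ℂ (fderiv ℂ ψ) (g 0) (iteratedDeriv 1 g 0) (iteratedDeriv 2 g 0) +
        (fderiv ℂ (fderiv ℂ ψ) (g 0) (iteratedDeriv 1 g 0) (iteratedDeriv 2 g 0) +
        fderiv ℂ (fderiv ℂ ψ) (g 0) (iteratedDeriv 2 g 0) (iteratedDeriv 1 g 0)) +
        fderiv ℂ (fderiv ℂ (fderiv ℂ ψ)) (g 0) (iteratedDeriv 1 g 0) (iteratedDeriv 1 g 0)
          (iteratedDeriv 1 g 0)) := by
  have hev := eventually_analyticAt_comp hg hψ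
  have h1 : deriv (ψ ∘ g) =ᶠ[𝓝 0] fun s => fderiv ℂ ψ (g s) (deriv g s) := by
    filter_upwards [hev] with s hs
    exact (hs.2.differentiableAt.hasFDerivAt.comp_hasDerivAt s
      hs.1.differentiableAt.hasDerivAt).deriv
  have h2 : deriv (deriv (ψ ∘ g)) =ᶠ[𝓝 0] fun s => fderiv ℂ ψ (g s) (deriv (deriv g) s) +
      fderiv ℂ (fderiv ℂ ψ) (g s) (deriv g s) (deriv g s) := by
    refine h1.deriv.trans ?_
    filter_upwards [hev] with s hs
    have e1 := hs.2.fderiv.differentiableAt.hasFDerivAt.comp_hasDerivAt s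
      hs.1.differentiableAt.hasDerivAt
    have e2 := e1.clm_apply hs.1.deriv.differentiableAt.hasDerivAt
    rw [add_comm]
    exact e2.deriv
  have h3 : deriv (deriv (deriv (ψ ∘ g))) 0 = fderiv ℂ ψ (g 0) (deriv (deriv (deriv g)) 0) +
      (fderiv ℂ (fderiv ℂ ψ) (g 0) (deriv g 0) (deriv (deriv g) 0) +
        (fderiv ℂ (fderiv ℂ ψ) (g 0) (deriv g 0) (deriv (deriv g) 0) +
        fderiv ℂ (fderiv ℂ ψ) (g 0) (deriv (deriv g) 0) (deriv g 0)) +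
        fderiv ℂ (fderiv ℂ (fderiv ℂ ψ)) (g 0) (deriv g 0) (deriv g 0) (deriv g 0)) := by
    rw [h2.deriv_eq]
    have e1 := hψ.fderiv.differentiableAt.hasFDerivAt.comp_hasDerivAt 0
      hg.differentiableAt.hasDerivAt
    have e2 := e1.clm_apply hg.deriv.deriv.differentiableAt.hasDerivAt
    have e3 := hψ.fderiv.fderiv.differentiableAt.hasFDerivAt.comp_hasDerivAt 0
      hg.differentiableAt.hasDerivAt
    have e4 := (e3.clm_apply hg.deriv.differentiableAt.hasDerivAt).clm_apply
      hg.deriv.differentiableAt.hasDerivAt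
    refine (e2.add e4).deriv.trans ?_
    simp only [_root_.add_apply, Function.comp_apply]
    abel
  simp only [iteratedDeriv_eq_iterate, Function.iterate_succ, Function.iterate_zero,
    Function.comp_apply, id]
  exact ⟨h1.self_of_nhds, h2.self_of_nhds, h3⟩

/-- The first three derivatives of `g ∘ φ`, for a change of variable `φ`. -/
theorem iteratedDeriv_comp_reparam {g : ℂ → E} {φ : ℂ → ℂ} (hφ : AnalyticAt ℂ φ 0)
    (hφ0 : φ 0 = 0) (hg : AnalyticAt ℂ g 0) :
    iteratedDeriv 1 (g ∘ φ) 0 = deriv φ 0 • iteratedDeriv 1 g 0 ∧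
    iteratedDeriv 2 (g ∘ φ) 0 = deriv φ 0 ^ 2 • iteratedDeriv 2 g 0 +
      iteratedDeriv 2 φ 0 • iteratedDeriv 1 g 0 ∧
    iteratedDeriv 3 (g ∘ φ) 0 = deriv φ 0 ^ 3 • iteratedDeriv 3 g 0 +
      (3 * deriv φ 0 * iteratedDeriv 2 φ 0) • iteratedDeriv 2 g 0 +
      iteratedDeriv 3 φ 0 • iteratedDeriv 1 g 0 := by
  have hev := eventually_analyticAt_comp (ψ := g) hφ (by rwa [hφ0])
  have h1 : deriv (g ∘ φ) =ᶠ[𝓝 0] fun s => deriv φ s • deriv g (φ s) := by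
    filter_upwards [hev] with s hs
    exact (hs.2.differentiableAt.hasDerivAt.scomp s hs.1.differentiableAt.hasDerivAt).deriv
  have h2 : deriv (deriv (g ∘ φ)) =ᶠ[𝓝 0] fun s =>
      deriv φ s • (deriv φ s • deriv (deriv g) (φ s)) + deriv (deriv φ) s • deriv g (φ s) := by
    refine h1.deriv.trans ?_
    filter_upwards [hev] with s hs
    have e1 := hs.2.deriv.differentiableAt.hasDerivAt.scomp s hs.1.differentiableAt.hasDerivAt
    exact (hs.1.deriv.differentiableAt.hasDerivAt.smul e1).deriv
  have h3 : deriv (deriv (deriv (g ∘ φ))) 0 =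
      (deriv φ 0 • (deriv φ 0 • (deriv φ 0 • deriv (deriv (deriv g)) (φ 0)) +
        deriv (deriv φ) 0 • deriv (deriv g) (φ 0)) +
      deriv (deriv φ) 0 • (deriv φ 0 • deriv (deriv g) (φ 0))) +
      (deriv (deriv φ) 0 • (deriv φ 0 • deriv (deriv g) (φ 0)) +
        deriv (deriv (deriv φ)) 0 • deriv g (φ 0)) := by
    rw [h2.deriv_eq]
    have hs := hev.self_of_nhds
    have e1 := hs.2.deriv.differentiableAt.hasDerivAt.scomp 0 hs.1.differentiableAt.hasDerivAt
    have e2 := hs.2.deriv.deriv.differentiableAt.hasDerivAt.scomp 0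
      hs.1.differentiableAt.hasDerivAt
    have d1 := hs.1.deriv.differentiableAt.hasDerivAt
    have d2 := hs.1.deriv.deriv.differentiableAt.hasDerivAt
    exact ((d1.smul (d1.smul e2)).add (d2.smul e1)).deriv
  rw [hφ0] at h3
  have h1' := h1.self_of_nhds
  have h2' := h2.self_of_nhds
  simp only [hφ0] at h1' h2'
  simp only [iteratedDeriv_eq_iterate, Function.iterate_succ, Function.iterate_zero,
    Function.comp_apply, id]
  refine ⟨h1', ?_, ?_⟩
  · rw [h2', smul_smul, sq]
  · rw [h3]
    module

end Derivatives

/-! ### Jets in charts -/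

section Charts

/-- The model of complex surfaces. -/
local notation "𝔼" => EuclideanSpace ℂ (Fin 2)

variable {S : Type*} [TopologicalSpace S] [ChartedSpace 𝔼 S]

theorem exists_reparam (a b c : ℂ) (ha : a ≠ 0) :
    ∃ φ : Reparam, deriv φ.toFun 0 = a ∧ iteratedDeriv 2 φ.toFun 0 = b ∧
      iteratedDeriv 3 φ.toFun 0 = c := by
  obtain ⟨h1, h2, h3⟩ := iteratedDeriv_cubic (0 : ℂ) a b c
  rw [iteratedDeriv_one] at h1
  exact ⟨⟨cubic 0 a b c, by simp [cubic], analyticAt_cubic _ _ _ _ _, by rwa [h1]⟩, h1, h2, h3⟩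

/-- The transition map from the chart at `x` to the chart at `x'`. -/
def transition (x x' : S) : 𝔼 → 𝔼 := chartAt 𝔼 x' ∘ (chartAt 𝔼 x).symm

theorem chart_eq_transition_comp {x y : S} (x' : S) (hy : y ∈ (chartAt 𝔼 x).source) :
    ⇑(chartAt 𝔼 x') =ᶠ[𝓝 y] transition x x' ∘ chartAt 𝔼 x := by
  filter_upwards [(chartAt 𝔼 x).open_source.mem_nhds hy] with z hz
  simp [transition, (chartAt 𝔼 x).left_inv hz]

variable [IsManifold 𝓘(ℂ, 𝔼) ω S]

theorem Curve.analyticAt {x y : S} (hy : y ∈ (chartAt 𝔼 x).source) (f : Curve (n := 2) y) :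
    AnalyticAt ℂ (chartAt 𝔼 x ∘ f.toFun) 0 := by
  have h1 : ContMDiffAt 𝓘(ℂ, 𝔼) 𝓘(ℂ, 𝔼) ω (chartAt 𝔼 x) (f.toFun 0) := by
    rw [f.map_zero]
    exact contMDiffAt_of_mem_maximalAtlas (IsManifold.chart_mem_maximalAtlas x) hy
  exact (contMDiffAt_iff_contDiffAt.1 (h1.comp 0 f.holo)).analyticAt

theorem Curve.coords_comp {x y : S} (hy : y ∈ (chartAt 𝔼 x).source) (f : Curve (n := 2) y)
    (φ : Reparam) :
    (f.comp φ).coords 3 (chartAt 𝔼 x) =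
      act (deriv φ.toFun 0) (iteratedDeriv 2 φ.toFun 0) (iteratedDeriv 3 φ.toFun 0)
        (f.coords 3 (chartAt 𝔼 x)) := by
  obtain ⟨h1, h2, h3⟩ := iteratedDeriv_comp_reparam φ.holo φ.map_zero (f.analyticAt hy)
  funext ⟨j, i⟩
  fin_cases j
  · exact congrArg (fun v : 𝔼 => v i) h1
  · exact congrArg (fun v : 𝔼 => v i) h2
  · exact congrArg (fun v : 𝔼 => v i) h3

/-- Since all values of the coordinates are attained, a jet function has only one polynomial in a
given chart, and invariance of the function becomes the polynomial identity `IsInv`. -/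
theorem Curve.exists_coords_eq {x y : S} (hy : y ∈ (chartAt 𝔼 x).source)
    (z : Fin 3 × Fin 2 → ℂ) : ∃ f : Curve (n := 2) y, f.coords 3 (chartAt 𝔼 x) = z := by
  let v : Fin 3 → 𝔼 := fun j => WithLp.toLp 2 fun i => z (j, i)
  let g : ℂ → 𝔼 := cubic (chartAt 𝔼 x y) (v 0) (v 1) (v 2)
  have hg0 : g 0 = chartAt 𝔼 x y := by simp [g, cubic]
  have hga : AnalyticAt ℂ g 0 := analyticAt_cubic _ _ _ _ _
  have hmem : g 0 ∈ (chartAt 𝔼 x).target := by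
    rw [hg0]
    exact (chartAt 𝔼 x).map_source hy
  have hsymm : ContMDiffAt 𝓘(ℂ, 𝔼) 𝓘(ℂ, 𝔼) ω (chartAt 𝔼 x).symm (g 0) :=
    contMDiffAt_symm_of_mem_maximalAtlas (IsManifold.chart_mem_maximalAtlas x) hmem
  let f : Curve (n := 2) y :=
    { toFun := (chartAt 𝔼 x).symm ∘ g
      map_zero := by rw [Function.comp_apply, hg0, (chartAt 𝔼 x).left_inv hy]
      holo := hsymm.comp 0 hga.contDiffAt.contMDiffAt }
  have hev : (chartAt 𝔼 x) ∘ f.toFun =ᶠ[𝓝 0] g := by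
    filter_upwards [hga.continuousAt.eventually ((chartAt 𝔼 x).open_target.mem_nhds hmem)]
      with s hs
    exact (chartAt 𝔼 x).right_inv hs
  obtain ⟨h1, h2, h3⟩ := iteratedDeriv_cubic (chartAt 𝔼 x y) (v 0) (v 1) (v 2)
  refine ⟨f, ?_⟩
  funext ⟨j, i⟩
  have := (hev.iteratedDeriv (j.val + 1)).self_of_nhds
  change iteratedDeriv (j.val + 1) ((chartAt 𝔼 x) ∘ f.toFun) 0 i = z (j, i)
  rw [this]
  fin_cases j
  · exact congrArg (fun v : 𝔼 => v i) h1
  · exact congrArg (fun v : 𝔼 => v i) h2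
  · exact congrArg (fun v : 𝔼 => v i) h3

theorem analyticAt_transition {x x' y : S} (hy : y ∈ (chartAt 𝔼 x).source)
    (hy' : y ∈ (chartAt 𝔼 x').source) :
    AnalyticAt ℂ (transition x x') (chartAt 𝔼 x y) := by
  have h1 : ContMDiffAt 𝓘(ℂ, 𝔼) 𝓘(ℂ, 𝔼) ω (chartAt 𝔼 x).symm (chartAt 𝔼 x y) :=
    contMDiffAt_symm_of_mem_maximalAtlas (IsManifold.chart_mem_maximalAtlas x)
      ((chartAt 𝔼 x).map_source hy)
  have h2 : ContMDiffAt 𝓘(ℂ, 𝔼) 𝓘(ℂ, 𝔼) ω (chartAt 𝔼 x') ((chartAt 𝔼 x).symm (chartAt 𝔼 x y)) := by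
    rw [(chartAt 𝔼 x).left_inv hy]
    exact contMDiffAt_of_mem_maximalAtlas (IsManifold.chart_mem_maximalAtlas x') hy'
  exact (contMDiffAt_iff_contDiffAt.1 (h2.comp _ h1)).analyticAt

/-- The Jacobian matrix at `y` of the transition map from the chart at `x` to the chart
at `x'`. -/
def jacobian (x x' y : S) (i k : Fin 2) : ℂ :=
  fderiv ℂ (transition x x') (chartAt 𝔼 x y) (EuclideanSpace.single k 1) i

theorem euclidean_eq_sum (v : 𝔼) : v = ∑ k, v k • EuclideanSpace.single k (1 : ℂ) := by
  ext i
  fin_cases i <;> simp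

theorem clm_apply_coord (L : 𝔼 →L[ℂ] 𝔼) (v : 𝔼) (i : Fin 2) :
    L v i = ∑ k, L (EuclideanSpace.single k 1) i * v k := by
  conv_lhs => rw [euclidean_eq_sum v]
  rw [map_sum]
  simp [mul_comm]

theorem clm_apply₂_coord (L : 𝔼 →L[ℂ] 𝔼 →L[ℂ] 𝔼) (v w : 𝔼) (i : Fin 2) :
    L v w i = ∑ k, ∑ k', L (EuclideanSpace.single k 1) (EuclideanSpace.single k' 1) i *
      (v k * w k') := by
  conv_lhs => rw [euclidean_eq_sum v, map_sum, _root_.sum_apply]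
  rw [WithLp.ofLp_sum, Finset.sum_apply]
  refine Finset.sum_congr rfl fun k _ => ?_
  rw [map_smul, _root_.smul_apply, PiLp.smul_apply, clm_apply_coord,
    Finset.smul_sum]
  refine Finset.sum_congr rfl fun k' _ => ?_
  rw [smul_eq_mul]
  ring

theorem clm_apply₃_coord (L : 𝔼 →L[ℂ] 𝔼 →L[ℂ] 𝔼 →L[ℂ] 𝔼) (u v w : 𝔼) (i : Fin 2) :
    L u v w i = ∑ j, ∑ k, ∑ k', L (EuclideanSpace.single j 1) (EuclideanSpace.single k 1)
      (EuclideanSpace.single k' 1) i * (u j * (v k * w k')) := by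
  conv_lhs => rw [euclidean_eq_sum u, map_sum, _root_.sum_apply,
    _root_.sum_apply]
  rw [WithLp.ofLp_sum, Finset.sum_apply]
  refine Finset.sum_congr rfl fun j _ => ?_
  rw [map_smul, _root_.smul_apply, _root_.smul_apply, PiLp.smul_apply,
    clm_apply₂_coord, Finset.smul_sum]
  refine Finset.sum_congr rfl fun k _ => ?_
  rw [Finset.smul_sum]
  refine Finset.sum_congr rfl fun k' _ => ?_
  rw [smul_eq_mul]
  ring

/-- The linear substitution given by a matrix on the derivatives of each order. -/
def linSubst (k : ℕ) (A : Fin 2 → Fin 2 → ℂ) (p : Fin k × Fin 2) :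
    MvPolynomial (Fin k × Fin 2) ℂ :=
  ∑ i, A p.2 i • X (p.1, i)

theorem isLead_linSubst_add (A : Fin 2 → Fin 2 → ℂ) (p : Fin 3 × Fin 2)
    {R : MvPolynomial (Fin 3 × Fin 2) ℂ} (hR : R ∈ ltSub 3 2 (Pi.single p.1 1)) :
    IsLead (linSubst 3 A p + R) (Pi.single p.1 1) (linSubst 3 A p) :=
  ⟨Submodule.sum_mem _ fun i _ => Submodule.smul_mem _ _ (X_mem_homSub (p.1, i)),
    by rwa [add_sub_cancel_left]⟩

theorem eval_linSubst (A : Fin 2 → Fin 2 → ℂ) (p : Fin 3 × Fin 2) (z : Fin 3 × Fin 2 → ℂ) :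
    eval z (linSubst 3 A p) = ∑ i, A p.2 i * z (p.1, i) := by
  simp [linSubst, smul_eval]

/-- The derivatives in the chart at `x'` are obtained from the derivatives in the chart at `x` by
a substitution that is triangular for the multidegree. -/
theorem exists_chart_change {x x' y : S} (hy : y ∈ (chartAt 𝔼 x).source)
    (hy' : y ∈ (chartAt 𝔼 x').source) :
    ∃ Θ : Fin 3 × Fin 2 → MvPolynomial (Fin 3 × Fin 2) ℂ,
      (∀ p, IsLead (Θ p) (Pi.single p.1 1) (linSubst 3 (jacobian x x' y) p)) ∧
      ∀ (f : Curve (n := 2) y) (p : Fin 3 × Fin 2),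
        f.coords 3 (chartAt 𝔼 x') p = eval (f.coords 3 (chartAt 𝔼 x)) (Θ p) := by
  let D₂ := fderiv ℂ (fderiv ℂ (transition x x')) (chartAt 𝔼 x y)
  let D₃ := fderiv ℂ (fderiv ℂ (fderiv ℂ (transition x x'))) (chartAt 𝔼 x y)
  let B : Fin 3 → Fin 3 → Fin 2 → MvPolynomial (Fin 3 × Fin 2) ℂ := fun a b i =>
    ∑ k, ∑ k', D₂ (EuclideanSpace.single k 1) (EuclideanSpace.single k' 1) i •
      (X (a, k) * X (b, k'))
  let T : Fin 2 → MvPolynomial (Fin 3 × Fin 2) ℂ := fun i =>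
    ∑ j, ∑ k, ∑ k', D₃ (EuclideanSpace.single j 1) (EuclideanSpace.single k 1)
      (EuclideanSpace.single k' 1) i • (X (0, j) * (X (0, k) * X (0, k')))
  have hB : ∀ a b i, B a b i ∈ homSub 3 2 (Pi.single a 1 + Pi.single b 1) := fun a b i =>
    Submodule.sum_mem _ fun k _ => Submodule.sum_mem _ fun k' _ => Submodule.smul_mem _ _
      (mul_mem_homSub (X_mem_homSub (a, k)) (X_mem_homSub (b, k')))
  have hT : ∀ i, T i ∈ homSub 3 2 (Pi.single 0 1 + (Pi.single 0 1 + Pi.single 0 1)) := fun i =>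
    Submodule.sum_mem _ fun j _ => Submodule.sum_mem _ fun k _ => Submodule.sum_mem _ fun k' _ =>
      Submodule.smul_mem _ _ (mul_mem_homSub (X_mem_homSub (0, j))
        (mul_mem_homSub (X_mem_homSub (0, k)) (X_mem_homSub (0, k'))))
  have lt_two : ∀ l : Fin 3 → ℕ, l 2 = 0 → homSub 3 2 l ≤ ltSub 3 2 (Pi.single 2 1) := by
    intro l hl
    refine (homSub_le_leSub l).trans (leSub_le_ltSub ?_)
    exact ⟨0, fun j hj => absurd hj (by simp), by simp [revLex, hl]⟩
  have lt_one : ∀ l : Fin 3 → ℕ, l 2 = 0 → l 1 = 0 →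
      homSub 3 2 l ≤ ltSub 3 2 (Pi.single 1 1) := by
    intro l hl hl'
    refine (homSub_le_leSub l).trans (leSub_le_ltSub ?_)
    -- The first entries compared, the degrees in f''', are both 0; the degree in f'' decides.
    refine ⟨1, fun j hj => ?_, by simp [revLex, hl']⟩
    obtain rfl : j = 0 := by omega
    simp [revLex, hl]
  -- The second and third order terms of the chain rule. The bilinear terms are kept in the order in
  -- which differentiation produces them, without using the symmetry of the second derivative.
  let low : Fin 3 × Fin 2 → MvPolynomial (Fin 3 × Fin 2) ℂ := fun p =>
    ![0, B 0 0 p.2, B 0 1 p.2 + (B 0 1 p.2 + B 1 0 p.2) + T p.2] p.1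
  refine ⟨fun p => linSubst 3 (jacobian x x' y) p + low p, fun p => ?_, fun f p => ?_⟩
  · refine isLead_linSubst_add _ p ?_
    obtain ⟨j, i⟩ := p
    fin_cases j
    · exact Submodule.zero_mem _
    · exact lt_one _ (by simp) (by simp) (hB 0 0 i)
    · refine Submodule.add_mem _ (Submodule.add_mem _ ?_ (Submodule.add_mem _ ?_ ?_)) ?_
      · exact lt_two _ (by simp) (hB 0 1 i)
      · exact lt_two _ (by simp) (hB 0 1 i)
      · exact lt_two _ (by simp) (hB 1 0 i)
      · exact lt_two _ (by simp) (hT i)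
  · have hf0 : (chartAt 𝔼 x ∘ f.toFun) 0 = chartAt 𝔼 x y := by
      rw [Function.comp_apply, f.map_zero]
    have hev : chartAt 𝔼 x' ∘ f.toFun =ᶠ[𝓝 0] transition x x' ∘ (chartAt 𝔼 x ∘ f.toFun) := by
      have hc : Filter.Tendsto f.toFun (𝓝 0) (𝓝 y) := by
        have := f.holo.continuousAt
        rwa [ContinuousAt, f.map_zero] at this
      exact hc.eventually (chart_eq_transition_comp x' hy)
    have hψ : AnalyticAt ℂ (transition x x') ((chartAt 𝔼 x ∘ f.toFun) 0) := by
      rw [hf0]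
      exact analyticAt_transition hy hy'
    obtain ⟨h1, h2, h3⟩ := iteratedDeriv_comp_le_three (f.analyticAt hy) hψ
    rw [hf0] at h1 h2 h3
    have hBe : ∀ (a b : Fin 3) (i : Fin 2), eval (f.coords 3 (chartAt 𝔼 x)) (B a b i) =
        D₂ (iteratedDeriv (a.val + 1) (chartAt 𝔼 x ∘ f.toFun) 0)
          (iteratedDeriv (b.val + 1) (chartAt 𝔼 x ∘ f.toFun) 0) i := by
      intro a b i
      rw [clm_apply₂_coord]
      simp only [B, map_sum, smul_eval, map_mul, eval_X]
      rfl
    have hTe : ∀ i : Fin 2, eval (f.coords 3 (chartAt 𝔼 x)) (T i) =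
        D₃ (iteratedDeriv 1 (chartAt 𝔼 x ∘ f.toFun) 0)
          (iteratedDeriv 1 (chartAt 𝔼 x ∘ f.toFun) 0)
          (iteratedDeriv 1 (chartAt 𝔼 x ∘ f.toFun) 0) i := by
      intro i
      rw [clm_apply₃_coord]
      simp only [T, map_sum, smul_eval, map_mul, eval_X]
      rfl
    have hLe : ∀ (j : Fin 3) (i : Fin 2),
        eval (f.coords 3 (chartAt 𝔼 x)) (linSubst 3 (jacobian x x' y) (j, i)) =
          fderiv ℂ (transition x x') (chartAt 𝔼 x y)
            (iteratedDeriv (j.val + 1) (chartAt 𝔼 x ∘ f.toFun) 0) i := by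
      intro j i
      rw [eval_linSubst, clm_apply_coord]
      rfl
    obtain ⟨j, i⟩ := p
    have hj := (hev.iteratedDeriv (j.val + 1)).self_of_nhds
    change iteratedDeriv (j.val + 1) (chartAt 𝔼 x' ∘ f.toFun) 0 i = _
    rw [hj, map_add, hLe]
    fin_cases j
    · have := congrArg (fun v : 𝔼 => v i) h1
      simpa [low] using this
    · have := congrArg (fun v : 𝔼 => v i) h2
      exact this.trans (congrArg (HAdd.hAdd _) (hBe 0 0 i).symm)
    · have := congrArg (fun v : 𝔼 => v i) h3
      have e : eval (f.coords 3 (chartAt 𝔼 x)) (low (2, i)) =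
          eval (f.coords 3 (chartAt 𝔼 x)) (B 0 1 i) + (eval (f.coords 3 (chartAt 𝔼 x)) (B 0 1 i) +
            eval (f.coords 3 (chartAt 𝔼 x)) (B 1 0 i)) +
          eval (f.coords 3 (chartAt 𝔼 x)) (T i) := by
        rw [← map_add, ← map_add, ← map_add]
        rfl
      rw [hBe, hBe, hTe] at e
      exact this.trans (congrArg (HAdd.hAdd _) e.symm)

end Charts

/-! ### Invariant jet differentials in charts -/

section Fibre

local notation "𝔼" => EuclideanSpace ℂ (Fin 2)

variable {S : Type*} [TopologicalSpace S] [ChartedSpace 𝔼 S]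

/-- The function on the jets given by a polynomial in the chart at the base point. -/
def evalJet (y : S) (P : MvPolynomial (Fin 3 × Fin 2) ℂ) : JetSpace 2 3 y → ℂ :=
  Quotient.lift (fun f : Curve (n := 2) y => eval (f.coords 3 (chartAt 𝔼 y)) P) fun f g h => by
    have : f.coords 3 (chartAt 𝔼 y) = g.coords 3 (chartAt 𝔼 y) := by
      funext p
      exact congrArg (fun v : 𝔼 => v p.2) (h (p.1.val + 1) p.1.2)
    simp only [this]

theorem represents_evalJet (y : S) (P : MvPolynomial (Fin 3 × Fin 2) ℂ) :
    Represents (chartAt 𝔼 y) P (evalJet y P) := fun _ => rfl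

theorem Represents.bind₁ {e e' : OpenPartialHomeomorph S 𝔼} {y : S}
    {Θ : Fin 3 × Fin 2 → MvPolynomial (Fin 3 × Fin 2) ℂ}
    (hΘ : ∀ (f : Curve (n := 2) y) (p : Fin 3 × Fin 2),
      f.coords 3 e' p = eval (f.coords 3 e) (Θ p))
    {P : MvPolynomial (Fin 3 × Fin 2) ℂ} {Q : JetSpace 2 3 y → ℂ} (h : Represents e' P Q) :
    Represents e (MvPolynomial.bind₁ Θ P) Q := by
  intro f
  rw [h f, funext (hΘ f)]
  exact (eval₂Hom_bind₁ _ _ _ _).symm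

theorem Represents.of_bind₁ {e e' : OpenPartialHomeomorph S 𝔼} {y : S}
    {Θ : Fin 3 × Fin 2 → MvPolynomial (Fin 3 × Fin 2) ℂ}
    (hΘ : ∀ (f : Curve (n := 2) y) (p : Fin 3 × Fin 2),
      f.coords 3 e' p = eval (f.coords 3 e) (Θ p))
    {P : MvPolynomial (Fin 3 × Fin 2) ℂ} {Q : JetSpace 2 3 y → ℂ}
    (h : Represents e (MvPolynomial.bind₁ Θ P) Q) : Represents e' P Q := by
  intro f
  rw [h f, funext (hΘ f)]
  exact eval₂Hom_bind₁ _ _ _ _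

/-- The Green–Griffiths homogeneity is the case of dilations. -/
theorem mem_invJet_of_forall {m : ℕ} {y : S} {P : MvPolynomial (Fin 3 × Fin 2) ℂ}
    {Q : JetSpace 2 3 y → ℂ} (h : Represents (chartAt 𝔼 y) P Q)
    (hinv : ∀ (f : Curve (n := 2) y) (φ : Reparam),
      Q ((f.comp φ).jet 3) = deriv φ.toFun 0 ^ m * Q (f.jet 3)) : Q ∈ invJet 2 3 m y := by
  refine ⟨⟨⟨P, by simp, h⟩, fun f c hc => ?_⟩, hinv⟩
  have := hinv f (Reparam.scale c hc)
  rw [this]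
  simp [Reparam.scale]

/-- The polynomial in the chart at `y` of an element of a step of the filtration. -/
def jetPoly {m : ℕ} {l : Fin 3 → ℕ} {y : S} (Q : filtLE 2 3 m l y) :
    MvPolynomial (Fin 3 × Fin 2) ℂ := Q.2.2.choose

theorem jetPoly_mem {m : ℕ} {l : Fin 3 → ℕ} {y : S} (Q : filtLE 2 3 m l y) :
    jetPoly Q ∈ leSub 3 2 l := Q.2.2.choose_spec.1

theorem represents_jetPoly {m : ℕ} {l : Fin 3 → ℕ} {y : S} (Q : filtLE 2 3 m l y) :
    Represents (chartAt 𝔼 y) (jetPoly Q) Q.1 := Q.2.2.choose_spec.2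

theorem mem_filtLT_of_homPart_eq_zero {m : ℕ} {l : Fin 3 → ℕ} {y : S} (Q : filtLE 2 3 m l y)
    (h : homPart l (jetPoly Q) = 0) : Q.1 ∈ filtLT 2 3 m l y :=
  ⟨Q.2.1, jetPoly Q, mem_ltSub_of_homPart_eq_zero (jetPoly_mem Q) h, represents_jetPoly Q⟩

variable [IsManifold 𝓘(ℂ, 𝔼) ω S]

theorem Represents.unique {x y : S} (hy : y ∈ (chartAt 𝔼 x).source)
    {P P' : MvPolynomial (Fin 3 × Fin 2) ℂ} {Q : JetSpace 2 3 y → ℂ}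
    (h : Represents (chartAt 𝔼 x) P Q) (h' : Represents (chartAt 𝔼 x) P' Q) : P = P' := by
  refine MvPolynomial.funext fun z => ?_
  obtain ⟨f, rfl⟩ := Curve.exists_coords_eq hy z
  exact (h f).symm.trans (h' f)

theorem isInv_of_mem_invJet {m : ℕ} {x y : S} (hy : y ∈ (chartAt 𝔼 x).source)
    {P : MvPolynomial (Fin 3 × Fin 2) ℂ} {Q : JetSpace 2 3 y → ℂ}
    (h : Represents (chartAt 𝔼 x) P Q) (hQ : Q ∈ invJet 2 3 m y) : IsInv m P := by
  intro a b c ha z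
  obtain ⟨f, rfl⟩ := Curve.exists_coords_eq hy z
  obtain ⟨φ, rfl, rfl, rfl⟩ := exists_reparam a b c ha
  rw [← Curve.coords_comp hy, ← h, ← h]
  exact hQ.2 f φ

theorem Represents.comp_reparam {m : ℕ} {x y : S} (hy : y ∈ (chartAt 𝔼 x).source)
    {P : MvPolynomial (Fin 3 × Fin 2) ℂ} {Q : JetSpace 2 3 y → ℂ}
    (h : Represents (chartAt 𝔼 x) P Q) (hP : IsInv m P) (f : Curve (n := 2) y) (φ : Reparam) :
    Q ((f.comp φ).jet 3) = deriv φ.toFun 0 ^ m * Q (f.jet 3) := by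
  rw [h, h, Curve.coords_comp hy, hP _ _ _ φ.deriv_ne]

theorem isInv_jetPoly {m : ℕ} {l : Fin 3 → ℕ} {y : S} (Q : filtLE 2 3 m l y) :
    IsInv m (jetPoly Q) :=
  isInv_of_mem_invJet (mem_chart_source 𝔼 y) (represents_jetPoly Q) Q.2.1

/-- The leading part of an invariant jet differential, as a polynomial in two tangent vectors. -/
def symbol (m : ℕ) (l : Fin 3 → ℕ) (y : S) :
    filtLE 2 3 m l y →ₗ[ℂ] MvPolynomial (Fin 2 × Fin 2) ℂ where
  toFun Q := merge (homPart l (jetPoly Q))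
  map_add' Q Q' := by
    rw [← map_add, ← map_add]
    congr 2
    refine Represents.unique (mem_chart_source 𝔼 y) (represents_jetPoly _) fun f => ?_
    rw [map_add, ← represents_jetPoly Q f, ← represents_jetPoly Q' f]
    rfl
  map_smul' a Q := by
    rw [RingHom.id_apply, ← map_smul, ← map_smul]
    congr 2
    refine Represents.unique (mem_chart_source 𝔼 y) (represents_jetPoly _) fun f => ?_
    rw [smul_eval, ← represents_jetPoly Q f]
    rfl

theorem exists_symbol_eq {m : ℕ} {l : Fin 3 → ℕ} (hl : l 0 + 2 * l 1 + 3 * l 2 = m) {y : S}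
    (Q : filtLE 2 3 m l y) :
    ∃ q : MvPolynomial (Fin 2) ℂ,
      homPart l (jetPoly Q) = ofFirst 3 q * wronskian 1 ^ l 1 * wronskian 2 ^ l 2 ∧
      symbol m l y Q = ofFirst 2 q * wronskian 1 ^ (l 1 + l 2) ∧
      ∀ d, coeff d q ≠ 0 → d.degree + (l 1 + l 2) = l 0 := by
  obtain ⟨q, h1, h2⟩ := (isInv_jetPoly Q).exists_homPart_eq (jetPoly_mem Q) hl
  refine ⟨q, h1, ?_, h2⟩
  change merge (homPart l (jetPoly Q)) = _
  rw [h1, merge_lead]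

/-- q can be recovered from q(f') W₁^N, so a vanishing symbol means a vanishing leading part. -/
theorem symbol_eq_zero_iff {m : ℕ} {l : Fin 3 → ℕ} (hl : l 0 + 2 * l 1 + 3 * l 2 = m) {y : S}
    (Q : filtLE 2 3 m l y) : symbol m l y Q = 0 ↔ Q.1 ∈ filtLT 2 3 m l y := by
  constructor
  · intro h
    obtain ⟨q, h1, h2, -⟩ := exists_symbol_eq hl Q
    rw [h2] at h
    rw [ofFirst_mul_wronskian_eq_zero h, map_zero, zero_mul, zero_mul] at h1
    exact mem_filtLT_of_homPart_eq_zero Q h1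
  · rintro ⟨-, P, hP, hP'⟩
    change merge (homPart l (jetPoly Q)) = 0
    rw [Represents.unique (mem_chart_source 𝔼 y) (represents_jetPoly Q) hP',
      homPart_of_mem_ltSub hP, map_zero]

theorem ker_symbol {m : ℕ} {l : Fin 3 → ℕ} (hl : l 0 + 2 * l 1 + 3 * l 2 = m) (y : S) :
    LinearMap.ker (symbol m l y) = (filtLT 2 3 m l y).submoduleOf (filtLE 2 3 m l y) := by
  ext Q
  exact symbol_eq_zero_iff hl Q

theorem subsingleton_grPiece {m : ℕ} {l : Fin 3 → ℕ} (hl : l 0 + 2 * l 1 + 3 * l 2 = m)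
    (hlt : l 0 < l 1 + 2 * l 2) (y : S) : Subsingleton (grPiece 2 3 m l y) := by
  rw [Submodule.Quotient.subsingleton_iff, eq_top_iff]
  intro Q _
  exact mem_filtLT_of_homPart_eq_zero Q
    ((isInv_jetPoly Q).homPart_eq_zero (jetPoly_mem Q) hl hlt)

/-- An invariant polynomial in some chart gives an invariant jet differential. -/
theorem exists_filtLE_represents {m : ℕ} {l : Fin 3 → ℕ} {x y : S}
    (hy : y ∈ (chartAt 𝔼 x).source) {P : MvPolynomial (Fin 3 × Fin 2) ℂ} (hP : IsInv m P)
    (hl : P ∈ leSub 3 2 l) : ∃ Q : filtLE 2 3 m l y, Represents (chartAt 𝔼 x) P Q.1 := by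
  obtain ⟨Θ, hΘ, hΘ'⟩ := exists_chart_change (mem_chart_source 𝔼 y) hy
  -- The filtration at y is read in the chart at y, so the polynomial is transported there;
  -- triangularity keeps it in the same step.
  have h1 : Represents (chartAt 𝔼 x) P (evalJet y (bind₁ Θ P)) :=
    Represents.of_bind₁ hΘ' (represents_evalJet y _)
  refine ⟨⟨evalJet y (bind₁ Θ P), mem_invJet_of_forall (represents_evalJet y _)
    (h1.comp_reparam hy hP), bind₁ Θ P, ?_, represents_evalJet y _⟩, h1⟩
  exact ((isLead_homPart hl).bind₁ hΘ).mem_leSub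

/-! ### The frames of the cotangent bundle -/

instance isManifold_one : IsManifold 𝓘(ℂ, 𝔼) 1 S := IsManifold.of_le (n := ω) le_top

theorem mfderiv_chart_bijective {x y : S} (hy : y ∈ (chartAt 𝔼 x).source) :
    Function.Bijective (mfderiv 𝓘(ℂ, 𝔼) 𝓘(ℂ, 𝔼) (chartAt 𝔼 x) y) :=
  (mdifferentiable_chart (I := 𝓘(ℂ, 𝔼)) x).mfderiv_bijective hy

/-- The frame `dz₁, dz₂` of the cotangent bundle on the domain of the chart at `x`. -/
def dzBasis (x y : S) (hy : y ∈ (chartAt 𝔼 x).source) :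
    Module.Basis (Fin 2) ℂ (Cotangent 2 y) :=
  (EuclideanSpace.basisFun (Fin 2) ℂ).toBasis.dualBasis.map
    (LinearEquiv.dualMap (LinearEquiv.ofBijective
      (mfderiv 𝓘(ℂ, 𝔼) 𝓘(ℂ, 𝔼) (chartAt 𝔼 x) y).toLinearMap (mfderiv_chart_bijective hy)))

theorem dualBasis_basisFun_apply (i : Fin 2) (w : 𝔼) :
    (EuclideanSpace.basisFun (Fin 2) ℂ).toBasis.dualBasis i w = w i := by
  simp

theorem dzBasis_apply {x y : S} (hy : y ∈ (chartAt 𝔼 x).source) (i : Fin 2) :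
    dzBasis x y hy i = dz x y i := by
  refine LinearMap.ext fun v => ?_
  rw [dzBasis, Module.Basis.map_apply]
  exact dualBasis_basisFun_apply i _

/-- The matrix is the one by which leading parts change in `exists_chart_change`; this is why the
symbol is a tensor. -/
theorem dz_change {x x' y : S} (hy : y ∈ (chartAt 𝔼 x).source)
    (hy' : y ∈ (chartAt 𝔼 x').source) (i : Fin 2) :
    dz x' y i = ∑ k, jacobian x x' y i k • dz x y k := by
  have h1 : mfderiv 𝓘(ℂ, 𝔼) 𝓘(ℂ, 𝔼) (chartAt 𝔼 x') y =
      (fderiv ℂ (transition x x') (chartAt 𝔼 x y)).comp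
        (mfderiv 𝓘(ℂ, 𝔼) 𝓘(ℂ, 𝔼) (chartAt 𝔼 x) y) := by
    rw [(chart_eq_transition_comp x' hy).mfderiv_eq]
    rw [mfderiv_comp (I' := 𝓘(ℂ, 𝔼)) y
      (analyticAt_transition hy hy').differentiableAt.mdifferentiableAt
      ((mdifferentiable_chart (I := 𝓘(ℂ, 𝔼)) x).mdifferentiableAt hy), mfderiv_eq_fderiv]
    rfl
  refine LinearMap.ext fun v => ?_
  have h2 := clm_apply_coord (fderiv ℂ (transition x x') (chartAt 𝔼 x y))
    (mfderiv 𝓘(ℂ, 𝔼) 𝓘(ℂ, 𝔼) (chartAt 𝔼 x) y v) i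
  rw [LinearMap.sum_apply]
  have h3 := congrArg (fun M : 𝔼 →L[ℂ] 𝔼 => M v i) h1
  exact h3.trans h2

/-! ### Chart independence of the symbol and the fibrewise isomorphism -/

theorem merge_bind₁_linSubst (A : Fin 2 → Fin 2 → ℂ) (R : MvPolynomial (Fin 3 × Fin 2) ℂ) :
    merge (bind₁ (linSubst 3 A) R) = bind₁ (linSubst 2 A) (merge R) := by
  have : merge.comp (bind₁ (linSubst 3 A)) = (bind₁ (linSubst 2 A)).comp merge := by
    refine MvPolynomial.algHom_ext fun p => ?_
    simp [merge, linSubst]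
  exact DFunLike.congr_fun this R

/-- The symbol does not depend on the chart. -/
theorem tensorPoly_eq_merge_homPart {m : ℕ} {l : Fin 3 → ℕ} {r : Fin 2 → ℕ} {x y : S}
    (hy : y ∈ (chartAt 𝔼 x).source) {Q : filtLE 2 3 m l y}
    {P : MvPolynomial (Fin 3 × Fin 2) ℂ} (hP : Represents (chartAt 𝔼 x) P Q.1)
    {T : ⨂[ℂ] _ : Box r, Cotangent 2 y}
    (hT : tensorPoly r (dzBasis y y (mem_chart_source 𝔼 y)) T = symbol m l y Q) :
    tensorPoly r (dzBasis x y hy) T = merge (homPart l P) := by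
  obtain ⟨Θ, hΘ, hΘ'⟩ := exists_chart_change hy (mem_chart_source 𝔼 y)
  have h1 : P = bind₁ Θ (jetPoly Q) :=
    Represents.unique hy hP ((represents_jetPoly Q).bind₁ hΘ')
  rw [h1, ((isLead_homPart (jetPoly_mem Q)).bind₁ hΘ).homPart_eq,
    tensorPoly_change (dzBasis y y (mem_chart_source 𝔼 y)) (dzBasis x y hy) (jacobian x y y)
      (fun i => by simp only [dzBasis_apply]; exact dz_change hy (mem_chart_source 𝔼 y) i), hT]
  exact (merge_bind₁_linSubst _ _).symm

/-- Both spaces embed in polynomials in two vectors with the same image, the q(f') W₁^N with q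
homogeneous of degree L - N. The bound N + l 2 ≤ L says that this degree is at least l 2, as lifting
requires. -/
theorem exists_fibre_equiv {m : ℕ} {l : Fin 3 → ℕ} (hl : l 0 + 2 * l 1 + 3 * l 2 = m)
    {L N : ℕ} (hL : l 0 = L) (hN : l 1 + l 2 = N) (hle : N + l 2 ≤ L) (y : S) :
    ∃ Ψ : grPiece 2 3 m l y ≃ₗ[ℂ] schur ![L, N] (Cotangent 2 y), ∀ Q : filtLE 2 3 m l y,
      tensorPoly ![L, N] (dzBasis y y (mem_chart_source 𝔼 y))
        (Ψ (Submodule.Quotient.mk Q)).1 = symbol m l y Q := by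
  obtain ⟨a, rfl⟩ := Nat.exists_eq_add_of_le (show N ≤ L by omega)
  set β := dzBasis y y (mem_chart_source 𝔼 y)
  let g : grPiece 2 3 m l y →ₗ[ℂ] MvPolynomial (Fin 2 × Fin 2) ℂ :=
    Submodule.liftQ _ (symbol m l y) (ker_symbol hl y).ge
  have hg : Function.Injective g := by
    rw [← LinearMap.ker_eq_bot]
    exact Submodule.ker_liftQ_eq_bot _ _ _ (ker_symbol hl y).le
  let τ : schur ![N + a, N] (Cotangent 2 y) →ₗ[ℂ] MvPolynomial (Fin 2 × Fin 2) ℂ :=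
    (tensorPoly ![N + a, N] β).domRestrict _
  have hτ : Function.Injective τ := fun T T' h =>
    Subtype.ext (tensorPoly_injOn β T.2 T'.2 h)
  have hrange : LinearMap.range g = LinearMap.range τ := by
    apply le_antisymm
    · rintro _ ⟨z, rfl⟩
      induction z using Submodule.Quotient.induction_on with
      | H Q =>
        obtain ⟨q, -, h2, h3⟩ := exists_symbol_eq hl Q
        obtain ⟨T, hT, hT'⟩ := exists_mem_schur β (N := N) (a := a) (q := q) fun d hd => by
          have := h3 d hd
          omega
        exact ⟨⟨T, hT⟩, by rw [hN] at h2; exact hT'.trans h2.symm⟩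
    · rintro _ ⟨T, rfl⟩
      obtain ⟨q, hq, hq'⟩ := exists_tensorPoly_eq β T.2
      have hq1 : ∀ d, coeff d q ≠ 0 → d.degree = a := fun d hd => by
        by_contra h
        exact hd (hq.coeff_eq_zero h)
      have hlead := isLead_lift (a := a) (b := l 1) (c := l 2) (by omega) (l := l) (by omega)
        rfl rfl hq1
      obtain ⟨Q, hQ⟩ := exists_filtLE_represents (m := m) (mem_chart_source 𝔼 y)
        (isInv_lift (a := a) (b := l 1) (c := l 2) (by omega) (by omega) q) hlead.mem_leSub
      refine ⟨Submodule.Quotient.mk Q, ?_⟩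
      refine Eq.trans ?_ hq'.symm
      change merge (homPart l (jetPoly Q)) = _
      rw [Represents.unique (mem_chart_source 𝔼 y) (represents_jetPoly Q) hQ, hlead.homPart_eq,
        merge_lead, hN]
  refine ⟨(LinearEquiv.ofInjective g hg).trans ((LinearEquiv.ofEq _ _ hrange).trans
    (LinearEquiv.ofInjective τ hτ).symm), fun Q => ?_⟩
  have h1 := (LinearEquiv.ofInjective τ hτ).apply_symm_apply
    (LinearEquiv.ofEq _ _ hrange (LinearEquiv.ofInjective g hg (Submodule.Quotient.mk Q)))
  have h2 := congrArg Subtype.val h1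
  exact h2

end Fibre

/-! ### The isomorphism of bundles -/

section Bundle

local notation "𝔼" => EuclideanSpace ℂ (Fin 2)

/-- The index types being finite, direct sums are products; summands outside the range of `e` are
zero. -/
theorem exists_directSum_equiv {ι κ : Type*} [Finite ι] [Finite κ] {M : ι → Type*}
    {N : κ → Type*} [∀ i, AddCommGroup (M i)] [∀ i, Module ℂ (M i)] [∀ k, AddCommGroup (N k)]
    [∀ k, Module ℂ (N k)] (e : κ → ι) (he : Function.Injective e)
    (hM : ∀ i, i ∉ Set.range e → Subsingleton (M i)) (Ψ : ∀ k, M (e k) ≃ₗ[ℂ] N k) :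
    ∃ Φ : (⨁ i, M i) ≃ₗ[ℂ] ⨁ k, N k, ∀ σ k, Φ σ k = Ψ k (σ (e k)) := by
  classical
  have := Fintype.ofFinite ι
  have := Fintype.ofFinite κ
  let G : (∀ i, M i) →ₗ[ℂ] ∀ k, N k :=
    LinearMap.pi fun k => (Ψ k).toLinearMap ∘ₗ LinearMap.proj (e k)
  have hG : Function.Bijective G := by
    constructor
    · rw [← LinearMap.ker_eq_bot, LinearMap.ker_eq_bot']
      intro σ hσ
      funext i
      by_cases hi : i ∈ Set.range e
      · obtain ⟨k, rfl⟩ := hi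
        exact (Ψ k).map_eq_zero_iff.1 (congrFun hσ k)
      · have := hM i hi
        exact Subsingleton.elim _ _
    · intro s
      refine ⟨∑ k, Pi.single (e k) ((Ψ k).symm (s k)), ?_⟩
      funext k
      change Ψ k ((∑ k', Pi.single (e k') ((Ψ k').symm (s k')) : ∀ i, M i) (e k)) = s k
      rw [Finset.sum_apply, Finset.sum_eq_single k]
      · rw [Pi.single_eq_same, LinearEquiv.apply_symm_apply]
      · intro k' _ hk'
        exact Pi.single_eq_of_ne (fun h => hk' (he h).symm) _
      · intro h
        exact absurd (Finset.mem_univ k) h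
  refine ⟨(DirectSum.linearEquivFunOnFintype ℂ ι M).trans ((LinearEquiv.ofBijective G hG).trans
    (DirectSum.linearEquivFunOnFintype ℂ κ N).symm), fun σ k => ?_⟩
  have := (DirectSum.linearEquivFunOnFintype ℂ κ N).apply_symm_apply
    (LinearEquiv.ofBijective G hG (DirectSum.linearEquivFunOnFintype ℂ ι M σ))
  exact congrFun this k

/-- The multidegree of the summand with index `(γ, λ₁, λ₂)`. -/
def SchurIndex.toWeight {m : ℕ} (p : SchurIndex m) : WeightIndex 3 m :=
  ⟨![p.lam₁, p.lam₂ - p.γ, p.γ], by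
    have h1 := p.weight
    have h2 := p.le_lam₂
    rw [Fin.sum_univ_three]
    simp
    omega⟩

theorem WeightIndex.eq {m : ℕ} (l : WeightIndex 3 m) :
    l.1 0 + 2 * l.1 1 + 3 * l.1 2 = m := by
  have := l.2
  rw [Fin.sum_univ_three] at this
  simp at this
  omega

theorem SchurIndex.toWeight_spec {m : ℕ} (p : SchurIndex m) :
    p.toWeight.1 0 = p.lam₁ ∧ p.toWeight.1 1 + p.toWeight.1 2 = p.lam₂ ∧
      p.lam₂ + p.toWeight.1 2 ≤ p.lam₁ := by
  have h2 := p.le_lam₂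
  have h3 := p.le_sub
  refine ⟨rfl, ?_, h3⟩
  change p.lam₂ - p.γ + p.γ = p.lam₂
  omega

theorem SchurIndex.toWeight_injective {m : ℕ} :
    Function.Injective (SchurIndex.toWeight (m := m)) := by
  intro p q h
  have h1 := congrArg Subtype.val h
  have e0 : p.lam₁ = q.lam₁ := congrFun h1 0
  have e2 : p.γ = q.γ := congrFun h1 2
  have e1 : p.lam₂ - p.γ = q.lam₂ - q.γ := congrFun h1 1
  have hp := p.le_lam₂
  have hq := q.le_lam₂
  obtain ⟨γ, a, b, _, _, _, _⟩ := p
  obtain ⟨γ', a', b', _, _, _, _⟩ := q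
  simp only at e0 e1 e2 hp hq
  obtain rfl : b = b' := by omega
  subst e0 e2
  rfl

theorem SchurIndex.exists_toWeight_eq {m : ℕ} (l : WeightIndex 3 m)
    (h : l.1 1 + 2 * l.1 2 ≤ l.1 0) : ∃ p : SchurIndex m, p.toWeight = l := by
  have := l.eq
  refine ⟨⟨l.1 2, l.1 0, l.1 1 + l.1 2, by omega, by omega, by omega, by omega⟩,
    Subtype.ext ?_⟩
  funext j
  fin_cases j
  · rfl
  · exact Nat.add_sub_cancel _ _
  · rfl

instance finite_weightIndex (m : ℕ) : Finite (WeightIndex 3 m) := by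
  have h : ∀ (l : WeightIndex 3 m) (j : Fin 3), l.1 j < m + 1 := by
    intro l j
    have := l.eq
    fin_cases j
    · change l.1 0 < m + 1; omega
    · change l.1 1 < m + 1; omega
    · change l.1 2 < m + 1; omega
  refine Finite.of_injective
    (fun (l : WeightIndex 3 m) (j : Fin 3) => (⟨l.1 j, h l j⟩ : Fin (m + 1)))
    fun l l' hll => Subtype.ext (funext fun j => ?_)
  exact congrArg Fin.val (congrFun hll j)

instance finite_schurIndex (m : ℕ) : Finite (SchurIndex m) :=
  Finite.of_injective _ SchurIndex.toWeight_injective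

/-! ### Correspondence of holomorphic sections -/

variable {S : Type*} [TopologicalSpace S] [ChartedSpace 𝔼 S]

theorem contMDiffAt_sum_const_mul {ι : Type*} (s : Finset ι) (a : ι → ℂ) {f : ι → S → ℂ} {x : S}
    (hf : ∀ i ∈ s, ContMDiffAt 𝓘(ℂ, 𝔼) 𝓘(ℂ, ℂ) ω (f i) x) :
    ContMDiffAt 𝓘(ℂ, 𝔼) 𝓘(ℂ, ℂ) ω (fun y => ∑ i ∈ s, a i * f i y) x := by
  classical
  induction s using Finset.induction_on with
  | empty =>
    simp only [Finset.sum_empty]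
    exact contMDiffAt_const
  | insert i s hi ih =>
    simp only [Finset.sum_insert hi]
    have h1 : ContMDiffAt 𝓘(ℂ, 𝔼) 𝓘(ℂ, ℂ) ω (fun _ : S => a i) x := contMDiffAt_const
    exact (h1.smul (hf i (Finset.mem_insert_self i s))).add
      (ih fun j hj => hf j (Finset.mem_insert_of_mem hj))

/-- The exponents of multidegree `l`. -/
def exponents (l : Fin 3 → ℕ) : Finset (Fin 3 × Fin 2 →₀ ℕ) :=
  {d ∈ Finset.finsuppAntidiag Finset.univ (∑ j, l j) | multidegree d = l}

theorem mem_exponents {l : Fin 3 → ℕ} {d : Fin 3 × Fin 2 →₀ ℕ} :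
    d ∈ exponents l ↔ multidegree d = l := by
  rw [exponents, Finset.mem_filter, and_iff_right_iff_imp]
  rintro rfl
  rw [Finset.mem_finsuppAntidiag]
  refine ⟨?_, Finset.subset_univ _⟩
  rw [Fintype.sum_prod_type]
  rfl

theorem homPart_eq_sum (l : Fin 3 → ℕ) (P : MvPolynomial (Fin 3 × Fin 2) ℂ) :
    homPart l P = ∑ d ∈ exponents l, coeff d P • monomial d 1 := by
  ext d
  simp only [coeff_homPart, coeff_sum, coeff_smul, coeff_monomial, smul_eq_mul, mul_ite, mul_one,
    mul_zero]
  rw [Finset.sum_ite_eq']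
  simp only [mem_exponents]

/-- The support of P y may vary with y, but the exponents of multidegree l form a fixed finite set.
The function is thus a finite combination, with constant coefficients, of coefficients of P y. -/
theorem contMDiffAt_apply_homPart (Λ : MvPolynomial (Fin 3 × Fin 2) ℂ →ₗ[ℂ] ℂ) (l : Fin 3 → ℕ)
    {P : S → MvPolynomial (Fin 3 × Fin 2) ℂ} {x : S}
    (hP : ∀ d, ContMDiffAt 𝓘(ℂ, 𝔼) 𝓘(ℂ, ℂ) ω (fun y => (P y).coeff d) x) :
    ContMDiffAt 𝓘(ℂ, 𝔼) 𝓘(ℂ, ℂ) ω (fun y => Λ (homPart l (P y))) x := by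
  have : (fun y => Λ (homPart l (P y))) =
      fun y => ∑ d ∈ exponents l, Λ (monomial d 1) * coeff d (P y) := by
    funext y
    rw [homPart_eq_sum, map_sum]
    simp only [map_smul, smul_eq_mul, mul_comm]
  rw [this]
  exact contMDiffAt_sum_const_mul _ _ fun d _ => hP d

/-- The coefficients of `q`, computed from `q(f') (f₁' f₂'' - f₂' f₁'')^N`. -/
theorem coeff_atSecond_lead (q : MvPolynomial (Fin 2) ℂ) (N : ℕ) (d : Fin 2 →₀ ℕ) :
    coeff (Finsupp.single 0 N + d) (atSecond 2 (ofFirst 2 q * wronskian 1 ^ N)) = coeff d q := by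
  rw [map_mul, map_pow, atSecond_ofFirst, atSecond_wronskian (by decide), mul_comm,
    X_pow_eq_monomial, coeff_monomial_mul, one_mul]

theorem holomorphicGrPiece_of_subsingleton {m : ℕ} {l : Fin 3 → ℕ}
    (h : ∀ y : S, Subsingleton (grPiece 2 3 m l y)) (σ : ∀ y : S, grPiece 2 3 m l y) (x : S) :
    IsHolomorphicGrPieceAt σ x := by
  refine ⟨fun _ => 0, ⟨fun _ => 0, Filter.Eventually.of_forall fun y f => by simp, fun d => ?_⟩,
    Filter.Eventually.of_forall fun y => ?_⟩
  · simp only [coeff_zero]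
    exact contMDiffAt_const
  · have := h y
    exact Subsingleton.elim _ _

variable [IsManifold 𝓘(ℂ, 𝔼) ω S]

/-- In the frame of the chart at x, the coefficients of the tensor are the constant linear forms
`tensorCoeff` applied to the symbol of a holomorphic lift. -/
theorem holomorphicTensor_of_grPiece {m : ℕ} {l : Fin 3 → ℕ} {r : Fin 2 → ℕ}
    (Ψ : ∀ y : S, grPiece 2 3 m l y ≃ₗ[ℂ] schur r (Cotangent 2 y))
    (hΨ : ∀ (y : S) (Q : filtLE 2 3 m l y),
      tensorPoly r (dzBasis y y (mem_chart_source 𝔼 y)) (Ψ y (Submodule.Quotient.mk Q)).1 =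
        symbol m l y Q)
    {σ : ∀ y : S, grPiece 2 3 m l y} {x : S} (h : IsHolomorphicGrPieceAt σ x) :
    IsHolomorphicTensorAt (fun y => (Ψ y (σ y)).1) x := by
  obtain ⟨Q, ⟨P, hP, hPd⟩, hQ⟩ := h
  refine ⟨fun a y => tensorCoeff r a (merge (homPart l (P y))), fun a =>
    contMDiffAt_apply_homPart (tensorCoeff r a ∘ₗ merge.toLinearMap) l hPd, ?_⟩
  filter_upwards [hP, hQ, (chartAt 𝔼 x).open_source.mem_nhds (mem_chart_source 𝔼 x)]
    with y h1 h2 hy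
  rw [← h2]
  conv_lhs => rw [eq_sum_tensorCoeff (dzBasis x y hy) (Ψ y (Submodule.Quotient.mk (Q y))).2]
  rw [tensorPoly_eq_merge_homPart hy h1 (hΨ y (Q y))]
  simp only [dzBasis_apply]

/-- The polynomial of the tensor determines q, and `lift` is linear in q, so it produces a lift with
holomorphic coefficients. -/
theorem holomorphicGrPiece_of_tensor {m : ℕ} {l : Fin 3 → ℕ}
    (hl : l 0 + 2 * l 1 + 3 * l 2 = m) {L N : ℕ} (hL : l 0 = L) (hN : l 1 + l 2 = N)
    (hle : N + l 2 ≤ L)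
    (Ψ : ∀ y : S, grPiece 2 3 m l y ≃ₗ[ℂ] schur ![L, N] (Cotangent 2 y))
    (hΨ : ∀ (y : S) (Q : filtLE 2 3 m l y),
      tensorPoly ![L, N] (dzBasis y y (mem_chart_source 𝔼 y))
        (Ψ y (Submodule.Quotient.mk Q)).1 = symbol m l y Q)
    {σ : ∀ y : S, grPiece 2 3 m l y} {x : S}
    (h : IsHolomorphicTensorAt (fun y => (Ψ y (σ y)).1) x) :
    IsHolomorphicGrPieceAt σ x := by
  classical
  obtain ⟨a, rfl⟩ := Nat.exists_eq_add_of_le (show N ≤ L by omega)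
  obtain ⟨c, hc, hT⟩ := h
  let R : S → MvPolynomial (Fin 2 × Fin 2) ℂ := fun y => ∑ α, c α y • monomial (boxExp α) 1
  -- Setting f'' = (0, 1) in q(f') W₁^N gives q multiplied by the N-th power of the first variable,
  -- hence the shift of exponents. This formula is defined for every y and visibly holomorphic near
  -- x.
  let q' : S → MvPolynomial (Fin 2) ℂ := fun y =>
    ∑ d ∈ Finset.finsuppAntidiag Finset.univ a,
      monomial d (coeff (Finsupp.single 0 N + d) (atSecond 2 (R y)))
  let P : S → MvPolynomial (Fin 3 × Fin 2) ℂ := fun y => lift a (l 1) (l 2) (q' y)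
  have hq' : ∀ y, ∀ d ∈ Finset.finsuppAntidiag (Finset.univ : Finset (Fin 2)) a,
      coeff d (q' y) = coeff (Finsupp.single 0 N + d) (atSecond 2 (R y)) := by
    intro y d hd
    simp only [q', coeff_sum, coeff_monomial]
    rw [Finset.sum_ite_eq', if_pos hd]
  have key : ∀ᶠ y in 𝓝 x, ∃ Q : filtLE 2 3 m l y, Represents (chartAt 𝔼 x) (P y) Q.1 ∧
      Submodule.Quotient.mk Q = σ y := by
    filter_upwards [hT, (chartAt 𝔼 x).open_source.mem_nhds (mem_chart_source 𝔼 x)] with y hTy hy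
    have h1 : tensorPoly ![N + a, N] (dzBasis x y hy) (Ψ y (σ y)).1 = R y := by
      rw [hTy, map_sum]
      refine Finset.sum_congr rfl fun α _ => ?_
      rw [map_smul, ← tensorPoly_tprod_basis (dzBasis x y hy) α]
      simp only [dzBasis_apply]
    obtain ⟨q, hq, hqR⟩ := exists_tensorPoly_eq (dzBasis x y hy) (Ψ y (σ y)).2
    have hq1 : ∀ d, coeff d q ≠ 0 → d.degree = a := fun d hd => by
      by_contra h
      exact hd (hq.coeff_eq_zero h)
    have hPq : P y = lift a (l 1) (l 2) q := by
      refine Finset.sum_congr rfl fun d hd => ?_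
      rw [hq' y d hd, ← h1, hqR, coeff_atSecond_lead]
    have hlead := isLead_lift (a := a) (b := l 1) (c := l 2) (by omega) (l := l) (by omega)
      rfl rfl hq1
    obtain ⟨Q, hQ⟩ := exists_filtLE_represents (m := m) hy
      (isInv_lift (a := a) (b := l 1) (c := l 2) (by omega) (by omega) q) hlead.mem_leSub
    refine ⟨Q, by rwa [hPq], (Ψ y).injective (Subtype.ext ?_)⟩
    refine tensorPoly_injOn (dzBasis x y hy) (Ψ y _).2 (Ψ y _).2 ?_
    rw [tensorPoly_eq_merge_homPart hy hQ (hΨ y Q), hlead.homPart_eq, merge_lead, hN, hqR]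
  -- The value 0 is used only where no lift exists, which does not happen near x. Lifts may be
  -- chosen fibre by fibre because P already determines them.
  refine ⟨fun y => if h : ∃ Q : filtLE 2 3 m l y, Represents (chartAt 𝔼 x) (P y) Q.1 ∧
    Submodule.Quotient.mk Q = σ y then h.choose else 0, ⟨P, ?_, fun d => ?_⟩, ?_⟩
  · filter_upwards [key] with y hy
    rw [dif_pos hy]
    exact hy.choose_spec.1
  · have hR : ∀ d', ContMDiffAt 𝓘(ℂ, 𝔼) 𝓘(ℂ, ℂ) ω (fun y => coeff d' (atSecond 2 (R y))) x := by
      intro d'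
      have : (fun y => coeff d' (atSecond 2 (R y))) = fun y =>
          ∑ α, coeff d' (atSecond 2 (monomial (boxExp α) 1)) * c α y := by
        funext y
        simp only [R, map_sum, map_smul, coeff_sum, coeff_smul, smul_eq_mul, mul_comm]
      rw [this]
      exact contMDiffAt_sum_const_mul _ _ fun α _ => hc α
    have : (fun y => coeff d (P y)) = fun y =>
        ∑ d' ∈ Finset.finsuppAntidiag Finset.univ a, coeff d (liftMono (l 1) (l 2) d') *
          coeff (Finsupp.single 0 N + d') (atSecond 2 (R y)) := by
      funext y
      simp only [P, lift, coeff_sum, coeff_smul, smul_eq_mul]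
      refine Finset.sum_congr rfl fun d' hd' => ?_
      rw [hq' y d' hd', mul_comm]
    rw [this]
    exact contMDiffAt_sum_const_mul _ _ fun d' _ => hR _
  · filter_upwards [key] with y hy
    rw [dif_pos hy]
    exact hy.choose_spec.2

end Bundle

end JetDiff

end

/-- On every complex surface `X` and for every `m`, there is an isomorphism of holomorphic vector
bundles from `Gr^• E_{3,m} T_X^*` to `⨁ Γ^{(λ₁, λ₂)} T_X^*`: a family of linear isomorphisms of the
fibres under which the holomorphic sections correspond to each other. -/
theorem mainTheorem3 {X : Type*} [TopologicalSpace X]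
    [ChartedSpace (EuclideanSpace ℂ (Fin 2)) X]
    [IsManifold 𝓘(ℂ, EuclideanSpace ℂ (Fin 2)) ω X] (m : ℕ) :
    ∃ Φ : ∀ x : X, JetDiff.GrInvJet 2 3 m x ≃ₗ[ℂ] JetDiff.SchurSum 2 m x,
      ∀ (σ : ∀ y : X, JetDiff.GrInvJet 2 3 m y) (x : X),
        JetDiff.IsHolomorphicGrAt σ x ↔
          JetDiff.IsHolomorphicSchurAt (fun y => Φ y (σ y)) x := by
  choose Ψ hΨ using fun (p : JetDiff.SchurIndex m) (y : X) =>
    JetDiff.exists_fibre_equiv p.toWeight.eq p.toWeight_spec.1 p.toWeight_spec.2.1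
      p.toWeight_spec.2.2 y
  -- The multidegrees that come from no triple are among those with l 0 < l 1 + 2 l 2, whose graded
  -- pieces vanish.
  have hsub : ∀ (l : JetDiff.WeightIndex 3 m) (y : X),
      l ∉ Set.range (JetDiff.SchurIndex.toWeight (m := m)) →
        Subsingleton (JetDiff.grPiece 2 3 m l.1 y) := by
    intro l y hl
    refine JetDiff.subsingleton_grPiece l.eq ?_ y
    by_contra h
    exact hl (JetDiff.SchurIndex.exists_toWeight_eq l (not_lt.1 h))
  choose Φ hΦ using fun y : X => JetDiff.exists_directSum_equiv
    (M := fun l : JetDiff.WeightIndex 3 m => JetDiff.grPiece 2 3 m l.1 y)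
    (N := fun p : JetDiff.SchurIndex m => JetDiff.schur ![p.lam₁, p.lam₂] (JetDiff.Cotangent 2 y))
    JetDiff.SchurIndex.toWeight JetDiff.SchurIndex.toWeight_injective (fun l => hsub l y)
    fun p => Ψ p y
  refine ⟨Φ, fun σ x => ⟨fun h p => ?_, fun h l => ?_⟩⟩
  · have := JetDiff.holomorphicTensor_of_grPiece (Ψ p) (hΨ p) (h p.toWeight)
    simpa only [hΦ] using this
  · by_cases hl : l ∈ Set.range (JetDiff.SchurIndex.toWeight (m := m))
    · obtain ⟨p, rfl⟩ := hl
      refine JetDiff.holomorphicGrPiece_of_tensor p.toWeight.eq p.toWeight_spec.1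
        p.toWeight_spec.2.1 p.toWeight_spec.2.2 (Ψ p) (hΨ p) ?_
      have := h p
      simpa only [hΦ] using this
    · exact JetDiff.holomorphicGrPiece_of_subsingleton (fun y => hsub l y hl) _ x
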